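/- Let $t\in\mathbb R$ with $t\neq 0,\pm1$, and let $U=U_t(su(2))$ be the complex Hopf algebra generated by $e,f,k^{\pm1}$ with relations $kk^{-1}=k^{-1}k=1$, $ke=t^2ek$, $kf=t^{-2}fk$, $[e,f]=\dfrac{k^2-k^{-2}}{t^2-t^{-2}}$, coproduct $\Delta(k^{\pm1})=k^{\pm1}\otimes k^{\pm1}$, $\Delta(e)=e\otimes k^{-1}+k\otimes e$, $\Delta(f)=f\otimes k^{-1}+k\otimes f$, counit $\varepsilon(k^{\pm1})=1$, $\varepsilon(e)=\varepsilon(f)=0$, and antipode $S(k)=k^{-1}$, $S(e)=-t^{-2}e$, $S(f)=-t^2f$. Let $\mathrm{ad}_a(b)=\sum a^{(1)}\,b\,S(a^{(2)})$ be the adjoint action of $U$ on itself. Write $[n]=\dfrac{t^{2n}-t^{-2n}}{t^2-t^{-2}}$ and $[n]!=[1][2]\cdots[n]$. For a natural number $l$ (including $0$) let $V^l$ be the irreducible representation of $U$ with weight basis $e^l_m$, $m=-l,\dots,l$, on which $$e\,e^l_m=([l-m][l+m+1])^{1/2}e^l_{m+1},\quad f\,e^l_m=([l+m][l-m+1])^{1/2}e^l_{m-1},\quad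 k^{\pm1}e^l_m=t^{\pm2m}e^l_m,$$ and let $$\lambda^l_m=\Big(\frac{[l+m]!}{[2l]!\,[l-m]!}\Big)^{1/2}\mathrm{ad}_{f^{\,l-m}}\big(e^lk^{-l}\big)\in U ,\qquad m=-l,\dots,l,$$ be the weight basis of the adjoint submodule $U^l\subset U$. For natural numbers $j,i$, Clebsch–Gordan coefficients $(jm,in|00)_t$ are numbers such that the vector $e^0_0=\sum_{m,n}(jm,in|00)_t\,e^j_m\otimes e^i_n$ is invariant in $V^j\otimes V^i$ (that is, $a\,e^0_0=\varepsilon(a)e^0_0$ for all $a\in U$), and $V^j\otimes V^i=\mathbb C e^0_0\oplus W$ for a subrepresentation $W$ without non-zero invariant vectors such that the component of $e^j_m\otimes e^i_n$ in $\mathbb Ce^0_0$ is $(jm,in|00)_t\,e^0_0$. Then: 1. the numbers $$(jm,in|00)_t=\frac{(-1)^{j-m}\,t^{-2m}}{\sqrt{[2j+1]}}\;\delta_{ji}\,\delta_{m,-n}$$ are such coefficients; 2. for any such coefficients, the element $$C=\sum_{m,n}(jm,in|00)_t\,\lambda^j_m\lambda^i_n\in U$$ satisfies $\mathrm{ad}_a(C)=\varepsilon(a)\,C$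 for all $a\in U$. For $j=i$ it spans a one-dimensional (trivial) representation of $U$ under $\mathrm{ad}$, i.e. $C\ne0$; for $j\neq i$ one has $C=0$. Consequently $C$ lies in the center of $U_t(su(2))$. -/

import Mathlib

open scoped TensorProduct

/-! ## Representations of Hopf algebras -/

namespace HopfRep

variable {A : Type*} [Ring A]

/-- The adjoint action `ad_a (b) = ∑ a₍₁₎ * b * S (a₍₂₎)` of a Hopf algebra on itself. -/
noncomputable def ad [HopfAlgebra ℂ A] : A →ₗ[ℂ] Module.End ℂ A :=
  TensorProduct.lift
    ((LinearMap.mul ℂ (Module.End ℂ A)).compl₁₂ (LinearMap.mul ℂ A)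
      ((LinearMap.mul ℂ A).flip ∘ₗ HopfAlgebra.antipode ℂ)) ∘ₗ Coalgebra.comul

/-- The tensor product `a (v ⊗ w) = ∑ a₍₁₎ v ⊗ a₍₂₎ w` of two representations. -/
noncomputable def tensorRep [Bialgebra ℂ A] {V W : Type*} [AddCommGroup V] [Module ℂ V]
    [AddCommGroup W] [Module ℂ W] (ρ : A →ₐ[ℂ] Module.End ℂ V) (π : A →ₐ[ℂ] Module.End ℂ W) :
    A →ₐ[ℂ] Module.End ℂ (V ⊗[ℂ] W) :=
  (Module.endTensorEndAlgHom.comp (Algebra.TensorProduct.map ρ π)).comp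
    (Bialgebra.comulAlgHom ℂ A)

/-- The subspace of invariant vectors `{v | ∀ a, ρ(a) v = ε(a) v}`. -/
def invariants [Bialgebra ℂ A] {V : Type*} [AddCommGroup V] [Module ℂ V]
    (ρ : A →ₗ[ℂ] Module.End ℂ V) : Submodule ℂ V where
  carrier := {v | ∀ a, ρ a v = Coalgebra.counit (R := ℂ) a • v}
  add_mem' hv hw a := by rw [map_add, hv a, hw a, smul_add]
  zero_mem' a := by simp
  smul_mem' c v hv a := by rw [map_smul, hv a, smul_comm]

end HopfRep

/-! ## The quantum algebra -/

namespace QuantumSU2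

section Algebra

inductive Gen
  | e | f | k | kinv

open FreeAlgebra in
/-- The defining relations, for the parameter `t`. -/
inductive Rel (t : ℝ) : FreeAlgebra ℂ Gen → FreeAlgebra ℂ Gen → Prop
  | k_kinv : Rel t (ι ℂ Gen.k * ι ℂ Gen.kinv) 1
  | kinv_k : Rel t (ι ℂ Gen.kinv * ι ℂ Gen.k) 1
  | k_e : Rel t (ι ℂ Gen.k * ι ℂ Gen.e) ((t : ℂ) ^ 2 • (ι ℂ Gen.e * ι ℂ Gen.k))
  | k_f : Rel t (ι ℂ Gen.k * ι ℂ Gen.f) (((t : ℂ) ^ 2)⁻¹ • (ι ℂ Gen.f * ι ℂ Gen.k))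
  | e_f : Rel t (ι ℂ Gen.e * ι ℂ Gen.f - ι ℂ Gen.f * ι ℂ Gen.e)
      (((t : ℂ) ^ 2 - ((t : ℂ) ^ 2)⁻¹)⁻¹ • (ι ℂ Gen.k ^ 2 - ι ℂ Gen.kinv ^ 2))

/-- The complex algebra `U_t(su(2))` by generators and relations: it is `U_t(sl(2))` for a real
parameter `t` (the real form is an anti-involution on it, which affects neither the Hopf algebra
structure nor the center). -/
def U (t : ℝ) : Type := RingQuot (Rel t)

variable (t : ℝ)

noncomputable instance : Ring (U t) := inferInstanceAs (Ring (RingQuot (Rel t)))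
noncomputable instance : Algebra ℂ (U t) := inferInstanceAs (Algebra ℂ (RingQuot (Rel t)))

noncomputable def gen (x : Gen) : U t := RingQuot.mkAlgHom ℂ (Rel t) (FreeAlgebra.ι ℂ x)

noncomputable abbrev e : U t := gen t Gen.e
noncomputable abbrev f : U t := gen t Gen.f
noncomputable abbrev k : U t := gen t Gen.k
noncomputable abbrev kinv : U t := gen t Gen.kinv

variable {t}

theorem k_kinv : k t * kinv t = 1 := by
  have h := RingQuot.mkAlgHom_rel ℂ (Rel.k_kinv (t := t))
  rw [map_mul, map_one] at h
  exact h

theorem kinv_k : kinv t * k t = 1 := by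
  have h := RingQuot.mkAlgHom_rel ℂ (Rel.kinv_k (t := t))
  rw [map_mul, map_one] at h
  exact h

theorem k_e : k t * e t = (t : ℂ) ^ 2 • (e t * k t) := by
  have h := RingQuot.mkAlgHom_rel ℂ (Rel.k_e (t := t))
  rw [map_mul, map_smul, map_mul] at h
  exact h

theorem k_f : k t * f t = ((t : ℂ) ^ 2)⁻¹ • (f t * k t) := by
  have h := RingQuot.mkAlgHom_rel ℂ (Rel.k_f (t := t))
  rw [map_mul, map_smul, map_mul] at h
  exact h

theorem e_f : e t * f t - f t * e t =
    ((t : ℂ) ^ 2 - ((t : ℂ) ^ 2)⁻¹)⁻¹ • (k t ^ 2 - kinv t ^ 2) := by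
  have h := RingQuot.mkAlgHom_rel ℂ (Rel.e_f (t := t))
  rw [map_sub, map_mul, map_mul, map_smul, map_sub, map_pow, map_pow] at h
  exact h

theorem e_kinv : e t * kinv t = (t : ℂ) ^ 2 • (kinv t * e t) := by
  calc e t * kinv t = kinv t * (k t * e t) * kinv t := by
        rw [← mul_assoc, kinv_k, one_mul]
    _ = (t : ℂ) ^ 2 • (kinv t * e t * (k t * kinv t)) := by
        rw [k_e]; simp [mul_assoc]
    _ = _ := by rw [k_kinv, mul_one]

theorem f_kinv : f t * kinv t = ((t : ℂ) ^ 2)⁻¹ • (kinv t * f t) := by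
  calc f t * kinv t = kinv t * (k t * f t) * kinv t := by
        rw [← mul_assoc, kinv_k, one_mul]
    _ = ((t : ℂ) ^ 2)⁻¹ • (kinv t * f t * (k t * kinv t)) := by
        rw [k_f]; simp [mul_assoc]
    _ = _ := by rw [k_kinv, mul_one]

/-- The algebra homomorphism out of `U t` given by images of the generators. -/
noncomputable def lift {B : Type*} [Ring B] [Algebra ℂ B] (g : Gen → B)
    (h₁ : g .k * g .kinv = 1) (h₂ : g .kinv * g .k = 1)
    (h₃ : g .k * g .e = (t : ℂ) ^ 2 • (g .e * g .k))
    (h₄ : g .k * g .f = ((t : ℂ) ^ 2)⁻¹ • (g .f * g .k))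
    (h₅ : g .e * g .f - g .f * g .e =
      ((t : ℂ) ^ 2 - ((t : ℂ) ^ 2)⁻¹)⁻¹ • (g .k ^ 2 - g .kinv ^ 2)) : U t →ₐ[ℂ] B :=
  RingQuot.liftAlgHom ℂ ⟨FreeAlgebra.lift ℂ g, by
    intro x y hxy
    cases hxy <;> simpa⟩

@[simp]
theorem lift_gen {B : Type*} [Ring B] [Algebra ℂ B] (g : Gen → B) (h₁ h₂ h₃ h₄ h₅) (x : Gen) :
    lift (t := t) g h₁ h₂ h₃ h₄ h₅ (gen t x) = g x := by
  unfold lift gen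
  erw [RingQuot.liftAlgHom_mkAlgHom_apply]
  simp

theorem hom_ext {B : Type*} [Semiring B] [Algebra ℂ B] {φ ψ : U t →ₐ[ℂ] B}
    (h : ∀ x, φ (gen t x) = ψ (gen t x)) : φ = ψ :=
  RingQuot.ringQuot_ext' ℂ φ ψ (FreeAlgebra.hom_ext (funext h))

theorem induction {P : U t → Prop} (hgen : ∀ x, P (gen t x)) (hc : ∀ c : ℂ, P (algebraMap ℂ _ c))
    (hadd : ∀ a b, P a → P b → P (a + b)) (hmul : ∀ a b, P a → P b → P (a * b)) (a : U t) :
    P a := by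
  obtain ⟨a, rfl⟩ := RingQuot.mkAlgHom_surjective ℂ (Rel t) a
  induction a using FreeAlgebra.induction with
  | grade0 r => rw [AlgHom.commutes]; exact hc r
  | grade1 x => exact hgen x
  | mul a b ha hb => rw [map_mul]; exact hmul _ _ ha hb
  | add a b ha hb => rw [map_add]; exact hadd _ _ ha hb

variable (t)

/-- The values of the comultiplication on the generators. -/
noncomputable def comulGen : Gen → U t ⊗[ℂ] U t
  | .e => e t ⊗ₜ kinv t + k t ⊗ₜ e t
  | .f => f t ⊗ₜ kinv t + k t ⊗ₜ f t
  | .k => k t ⊗ₜ k t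
  | .kinv => kinv t ⊗ₜ kinv t

/-- The values of the counit on the generators. -/
def counitGen : Gen → ℂ
  | .e => 0
  | .f => 0
  | .k => 1
  | .kinv => 1

/-- The values of the antipode on the generators. -/
noncomputable def antipodeGen : Gen → U t
  | .e => -(((t : ℂ) ^ 2)⁻¹ • e t)
  | .f => -((t : ℂ) ^ 2 • f t)
  | .k => kinv t
  | .kinv => k t

variable [NeZero t]

theorem sq_ne_zero' : (t : ℂ) ^ 2 ≠ 0 := pow_ne_zero _ (by exact_mod_cast NeZero.ne t)

noncomputable def comulHom : U t →ₐ[ℂ] U t ⊗[ℂ] U t :=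
  lift (comulGen t)
    (by simp [comulGen, k_kinv, Algebra.TensorProduct.one_def])
    (by simp [comulGen, kinv_k, Algebra.TensorProduct.one_def])
    (by
      simp only [comulGen, mul_add, add_mul, Algebra.TensorProduct.tmul_mul_tmul, k_e,
        k_kinv, kinv_k, smul_add, TensorProduct.smul_tmul', TensorProduct.tmul_smul])
    (by
      simp only [comulGen, mul_add, add_mul, Algebra.TensorProduct.tmul_mul_tmul, k_f,
        k_kinv, kinv_k, smul_add, TensorProduct.smul_tmul', TensorProduct.tmul_smul])
    (by
      have h := sq_ne_zero' t
      have h1 : kinv t * f t = (t : ℂ) ^ 2 • (f t * kinv t) := by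
        rw [f_kinv, smul_smul, mul_inv_cancel₀ h, one_smul]
      have key : (e t ⊗ₜ[ℂ] kinv t + k t ⊗ₜ[ℂ] e t) * (f t ⊗ₜ[ℂ] kinv t + k t ⊗ₜ[ℂ] f t)
          - (f t ⊗ₜ[ℂ] kinv t + k t ⊗ₜ[ℂ] f t) * (e t ⊗ₜ[ℂ] kinv t + k t ⊗ₜ[ℂ] e t)
          = (e t * f t - f t * e t) ⊗ₜ[ℂ] (kinv t * kinv t)
            + (k t * k t) ⊗ₜ[ℂ] (e t * f t - f t * e t) := by
        simp only [mul_add, add_mul, Algebra.TensorProduct.tmul_mul_tmul, k_e, k_f, h1, e_kinv,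
          TensorProduct.tmul_smul, ← TensorProduct.smul_tmul', smul_smul, mul_inv_cancel₀ h,
          one_smul, TensorProduct.sub_tmul, TensorProduct.tmul_sub]
        abel
      simp only [comulGen]
      rw [key, e_f]
      simp only [pow_two, Algebra.TensorProduct.tmul_mul_tmul, ← TensorProduct.smul_tmul',
        TensorProduct.tmul_smul, TensorProduct.sub_tmul, TensorProduct.tmul_sub, ← smul_add]
      congr 1
      abel)

noncomputable def counitHom : U t →ₐ[ℂ] ℂ :=
  lift counitGen (by simp [counitGen]) (by simp [counitGen]) (by simp [counitGen])
    (by simp [counitGen]) (by simp [counitGen])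

/-- The antipode, as an algebra homomorphism to the opposite algebra. -/
noncomputable def antipodeHom : U t →ₐ[ℂ] (U t)ᵐᵒᵖ :=
  lift (fun x => MulOpposite.op (antipodeGen t x))
    (by simp [antipodeGen, ← MulOpposite.op_mul, k_kinv])
    (by simp [antipodeGen, ← MulOpposite.op_mul, kinv_k])
    (by
      rw [← MulOpposite.op_mul, ← MulOpposite.op_mul, ← MulOpposite.op_smul]
      simp [antipodeGen, e_kinv, smul_smul, mul_comm])
    (by
      rw [← MulOpposite.op_mul, ← MulOpposite.op_mul, ← MulOpposite.op_smul]
      simp [antipodeGen, f_kinv, smul_smul, mul_comm])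
    (by
      have h := sq_ne_zero' t
      rw [← MulOpposite.op_mul, ← MulOpposite.op_mul, ← MulOpposite.op_pow, ← MulOpposite.op_pow,
        ← MulOpposite.op_sub, ← MulOpposite.op_sub, ← MulOpposite.op_smul]
      congr 1
      have h2 := congrArg (fun x => -x) (e_f (t := t))
      simp only [neg_sub, ← smul_neg] at h2
      simp only [antipodeGen, neg_mul_neg, smul_mul_smul_comm, mul_inv_cancel₀ h,
        inv_mul_cancel₀ h, one_smul]
      rw [← h2])

noncomputable instance : Bialgebra ℂ (U t) :=
  Bialgebra.ofAlgHom (comulHom t) (counitHom t)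
    (by
      apply hom_ext
      intro x
      cases x <;>
        simp [comulHom, comulGen, TensorProduct.tmul_add, TensorProduct.add_tmul, add_assoc])
    (by
      apply hom_ext
      intro x
      cases x <;> simp [comulHom, counitHom, comulGen, counitGen])
    (by
      apply hom_ext
      intro x
      cases x <;> simp [comulHom, counitHom, comulGen, counitGen])

noncomputable def antipodeLin : U t →ₗ[ℂ] U t :=
  (MulOpposite.opLinearEquiv ℂ).symm.toLinearMap ∘ₗ (antipodeHom t).toLinearMap

theorem antipodeLin_gen (x : Gen) : antipodeLin t (gen t x) = antipodeGen t x := by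
  simp [antipodeLin, antipodeHom]

theorem antipodeLin_mul (a b : U t) :
    antipodeLin t (a * b) = antipodeLin t b * antipodeLin t a := by
  simp [antipodeLin]

theorem antipodeLin_algebraMap (c : ℂ) :
    antipodeLin t (algebraMap ℂ _ c) = algebraMap ℂ _ c := by
  simp [antipodeLin]

theorem antipode_left (a : U t) :
    LinearMap.mul' ℂ (U t) ((antipodeLin t).rTensor (U t) (comulHom t a)) =
      algebraMap ℂ (U t) (counitHom t a) := by
  have key : ∀ (c : ℂ) (z w : U t ⊗[ℂ] U t),
      LinearMap.mul' ℂ (U t) ((antipodeLin t).rTensor (U t) z) = algebraMap ℂ (U t) c →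
      LinearMap.mul' ℂ (U t) ((antipodeLin t).rTensor (U t) (z * w)) =
        c • LinearMap.mul' ℂ (U t) ((antipodeLin t).rTensor (U t) w) := by
    intro c z w hz
    induction w with
    | zero => simp
    | add x y hx hy => simp only [mul_add, map_add, hx, hy, smul_add]
    | tmul x y =>
      have : ∀ z : U t ⊗[ℂ] U t,
          LinearMap.mul' ℂ (U t) ((antipodeLin t).rTensor (U t) (z * (x ⊗ₜ y))) =
          antipodeLin t x * LinearMap.mul' ℂ (U t) ((antipodeLin t).rTensor (U t) z) * y := by
        intro z
        induction z with
        | zero => simp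
        | add x y hx hy => simp only [add_mul, mul_add, map_add, hx, hy]
        | tmul p q => simp [antipodeLin_mul, mul_assoc]
      rw [this, hz]
      simp [Algebra.algebraMap_eq_smul_one]
  induction a using induction with
  | hgen x =>
    cases x <;>
      simp [comulHom, counitHom, comulGen, counitGen, antipodeLin_gen, antipodeGen, e_kinv,
        f_kinv, smul_smul, inv_mul_cancel₀ (sq_ne_zero' t),
        mul_inv_cancel₀ (sq_ne_zero' t), k_kinv, kinv_k]
  | hc c => simp [Algebra.TensorProduct.algebraMap_apply, antipodeLin_algebraMap]
  | hadd a b ha hb => simp only [map_add, ha, hb]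
  | hmul a b ha hb =>
    rw [map_mul, key _ _ _ ha, hb, map_mul, map_mul, Algebra.smul_def]

theorem antipode_right (a : U t) :
    LinearMap.mul' ℂ (U t) ((antipodeLin t).lTensor (U t) (comulHom t a)) =
      algebraMap ℂ (U t) (counitHom t a) := by
  have key : ∀ (c : ℂ) (z w : U t ⊗[ℂ] U t),
      LinearMap.mul' ℂ (U t) ((antipodeLin t).lTensor (U t) w) = algebraMap ℂ (U t) c →
      LinearMap.mul' ℂ (U t) ((antipodeLin t).lTensor (U t) (z * w)) =
        c • LinearMap.mul' ℂ (U t) ((antipodeLin t).lTensor (U t) z) := by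
    intro c z w hw
    induction z with
    | zero => simp
    | add x y hx hy => simp only [add_mul, map_add, hx, hy, smul_add]
    | tmul x y =>
      have : ∀ w : U t ⊗[ℂ] U t,
          LinearMap.mul' ℂ (U t) ((antipodeLin t).lTensor (U t) ((x ⊗ₜ y) * w)) =
          x * LinearMap.mul' ℂ (U t) ((antipodeLin t).lTensor (U t) w) * antipodeLin t y := by
        intro w
        induction w with
        | zero => simp
        | add x y hx hy => simp only [add_mul, mul_add, map_add, hx, hy]
        | tmul p q => simp [antipodeLin_mul, mul_assoc]
      rw [this, hw]
      simp [Algebra.algebraMap_eq_smul_one]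
  have hone : antipodeLin t 1 = 1 := by simpa using antipodeLin_algebraMap t 1
  induction a using induction with
  | hgen x =>
    cases x <;>
      simp [comulHom, counitHom, comulGen, counitGen, antipodeLin_gen, antipodeGen, k_e,
        k_f, smul_smul, inv_mul_cancel₀ (sq_ne_zero' t),
        mul_inv_cancel₀ (sq_ne_zero' t), k_kinv, kinv_k]
  | hc c => simp [Algebra.TensorProduct.algebraMap_apply, hone]
  | hadd a b ha hb => simp only [map_add, ha, hb]
  | hmul a b ha hb =>
    rw [map_mul, key _ _ _ hb, ha, map_mul, map_mul, Algebra.smul_def]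
    exact Algebra.commutes _ _

noncomputable instance : HopfAlgebra ℂ (U t) where
  antipode := antipodeLin t
  mul_antipode_rTensor_comul := LinearMap.ext (antipode_left t)
  mul_antipode_lTensor_comul := LinearMap.ext (antipode_right t)

end Algebra

/-! ## Quantum integers, weights and the irreducible representations -/

/-- The quantum integer `[n] = (t^{2n} - t^{-2n}) / (t^2 - t^{-2})`. -/
noncomputable def qInt (t : ℝ) (n : ℤ) : ℝ :=
  (t ^ (2 * n) - t ^ (-(2 * n))) / (t ^ 2 - (t ^ 2)⁻¹)

/-- The quantum factorial `[n]! = [1] [2] ⋯ [n]`. -/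
noncomputable def qFact (t : ℝ) (n : ℕ) : ℝ := ∏ i ∈ Finset.range n, qInt t (i + 1)

/-- The weights `-l, …, l` of the representation of (integer) spin `l`. -/
abbrev Weight (l : ℕ) : Type := Finset.Icc (-(l : ℤ)) l

/-- The space of the representation of spin `l`, with basis indexed by the weights. -/
abbrev V (l : ℕ) : Type := Weight l → ℂ

/-- The weight basis `e_m^l` of `V l`. -/
noncomputable abbrev vec {l : ℕ} (m : Weight l) : V l := Pi.single m 1

/-- The matrices of the generators in the weight basis (column `m`, row `p`):
`e` sends `e_m` to `([l-m] [l+m+1])^{1/2} e_{m+1}`, `f` sends `e_m` to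
`([l+m] [l-m+1])^{1/2} e_{m-1}` and `k^{±1}` sends `e_m` to `t^{±2m} e_m`. -/
noncomputable def repGen (t : ℝ) (l : ℕ) : Gen → Matrix (Weight l) (Weight l) ℂ
  | .e => Matrix.of fun p m =>
      if (p : ℤ) = m + 1 then (Real.sqrt (qInt t (l - m) * qInt t (l + m + 1)) : ℂ) else 0
  | .f => Matrix.of fun p m =>
      if (p : ℤ) = m - 1 then (Real.sqrt (qInt t (l + m) * qInt t (l - m + 1)) : ℂ) else 0
  | .k => Matrix.diagonal fun m => (t : ℂ) ^ (2 * (m : ℤ))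
  | .kinv => Matrix.diagonal fun m => (t : ℂ) ^ (-(2 * (m : ℤ)))

theorem qInt_nonneg (t : ℝ) [NeZero t] {n : ℤ} (hn : 0 ≤ n) : 0 ≤ qInt t n := by
  have ht : t ≠ 0 := NeZero.ne t
  have hx : 0 < t ^ 2 := by positivity
  lift n to ℕ using hn
  have e1 : t ^ (2 * (n : ℤ)) = (t ^ 2) ^ n := by
    rw [zpow_mul]; simp
  unfold qInt
  rw [zpow_neg, e1]
  generalize t ^ 2 = x at hx
  rcases le_total 1 x with h | h
  · have h1 : 1 ≤ x ^ n := one_le_pow₀ h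
    exact div_nonneg (sub_nonneg.2 ((inv_le_one_of_one_le₀ h1).trans h1))
      (sub_nonneg.2 ((inv_le_one_of_one_le₀ h).trans h))
  · have h1 : x ^ n ≤ 1 := pow_le_one₀ hx.le h
    exact div_nonneg_of_nonpos
      (sub_nonpos.2 (h1.trans ((one_le_inv₀ (pow_pos hx n)).2 h1)))
      (sub_nonpos.2 (h.trans ((one_le_inv₀ hx).2 h)))

theorem qInt_identity (t : ℝ) [NeZero t] (l m : ℤ) :
    qInt t (l + m) * qInt t (l - m + 1) - qInt t (l - m) * qInt t (l + m + 1) =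
      (t ^ 2 - (t ^ 2)⁻¹)⁻¹ * (t ^ (4 * m) - t ^ (-(4 * m))) := by
  have ht : t ≠ 0 := NeZero.ne t
  unfold qInt
  by_cases hD : t ^ 2 - (t ^ 2)⁻¹ = 0
  · simp [hD]
  have hnum : (t ^ (2 * (l + m)) - t ^ (-(2 * (l + m)))) *
        (t ^ (2 * (l - m + 1)) - t ^ (-(2 * (l - m + 1)))) -
      (t ^ (2 * (l - m)) - t ^ (-(2 * (l - m)))) *
        (t ^ (2 * (l + m + 1)) - t ^ (-(2 * (l + m + 1)))) =
      (t ^ 2 - (t ^ 2)⁻¹) * (t ^ (4 * m) - t ^ (-(4 * m))) := by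
    have h2 : t ^ 2 = t ^ (2 : ℤ) := by norm_cast
    have h3 : (t ^ 2)⁻¹ = t ^ (-2 : ℤ) := by rw [zpow_neg]; norm_cast
    rw [h3, h2]
    simp only [sub_mul, mul_sub, ← zpow_add₀ ht]
    ring_nf
  rw [div_mul_div_comm, div_mul_div_comm, ← sub_div, hnum]
  field_simp

theorem sqrt_mul_self_qInt (t : ℝ) [NeZero t] {a b : ℤ} (ha : 0 ≤ a) (hb : 0 ≤ b) :
    (Real.sqrt (qInt t a * qInt t b) : ℂ) * (Real.sqrt (qInt t a * qInt t b) : ℂ) =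
      ((qInt t a * qInt t b : ℝ) : ℂ) := by
  rw [← Complex.ofReal_mul, Real.mul_self_sqrt
    (mul_nonneg (qInt_nonneg t ha) (qInt_nonneg t hb))]

theorem repGen_e_mul_f (t : ℝ) [NeZero t] (l : ℕ) :
    repGen t l .e * repGen t l .f =
      Matrix.diagonal fun m : Weight l => ((qInt t (l + m) * qInt t (l - m + 1) : ℝ) : ℂ) := by
  ext p m
  obtain ⟨m, hm⟩ := m
  obtain ⟨p, hp⟩ := p
  have hm' := Finset.mem_Icc.1 hm
  have hp' := Finset.mem_Icc.1 hp
  simp only [Matrix.mul_apply, repGen, Matrix.of_apply, Matrix.diagonal_apply, Subtype.mk.injEq]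
  by_cases hlow : m = -l
  · have h0 : qInt t (l + m) = 0 := by simp [hlow, qInt]
    rw [h0]
    simp
    rintro rfl
    exact Or.inl h0
  · have hx : m - 1 ∈ Finset.Icc (-(l : ℤ)) l := Finset.mem_Icc.2 ⟨by omega, by omega⟩
    rw [Finset.sum_eq_single (⟨m - 1, hx⟩ : Weight l)]
    · by_cases hpm : p = m
      · subst hpm
        simp only [sub_add_cancel, if_true]
        rw [show (l : ℤ) - (p - 1) = l - p + 1 by ring, show (l : ℤ) + (p - 1) + 1 = l + p by ring,
          mul_comm (qInt t (l - p + 1))]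
        exact sqrt_mul_self_qInt t (by omega) (by omega)
      · simp [hpm]
    · rintro ⟨x, hx'⟩ - hne
      rw [if_neg (c := x = m - 1) (fun h => hne (Subtype.ext h)), mul_zero]
    · simp

theorem repGen_f_mul_e (t : ℝ) [NeZero t] (l : ℕ) :
    repGen t l .f * repGen t l .e =
      Matrix.diagonal fun m : Weight l => ((qInt t (l - m) * qInt t (l + m + 1) : ℝ) : ℂ) := by
  ext p m
  obtain ⟨m, hm⟩ := m
  obtain ⟨p, hp⟩ := p
  have hm' := Finset.mem_Icc.1 hm
  have hp' := Finset.mem_Icc.1 hp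
  simp only [Matrix.mul_apply, repGen, Matrix.of_apply, Matrix.diagonal_apply, Subtype.mk.injEq]
  by_cases hlow : m = l
  · have h0 : qInt t (l - m) = 0 := by simp [hlow, qInt]
    rw [h0]
    simp
    rintro rfl
    exact Or.inl h0
  · have hx : m + 1 ∈ Finset.Icc (-(l : ℤ)) l := Finset.mem_Icc.2 ⟨by omega, by omega⟩
    rw [Finset.sum_eq_single (⟨m + 1, hx⟩ : Weight l)]
    · by_cases hpm : p = m
      · subst hpm
        simp only [add_sub_cancel_right, if_true]
        rw [show (l : ℤ) - (p + 1) + 1 = l - p by ring, show (l : ℤ) + (p + 1) = l + p + 1 by ring,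
          mul_comm (qInt t (l + p + 1))]
        exact sqrt_mul_self_qInt t (by omega) (by omega)
      · simp [hpm]
    · rintro ⟨x, hx'⟩ - hne
      rw [if_neg (c := x = m + 1) (fun h => hne (Subtype.ext h)), mul_zero]
    · simp

/-- The irreducible representation `π^l` of `U t` of spin `l`, on `V l`. -/
noncomputable def rep (t : ℝ) [NeZero t] (l : ℕ) : U t →ₐ[ℂ] Module.End ℂ (V l) :=
  (Matrix.toLinAlgEquiv' : Matrix (Weight l) (Weight l) ℂ ≃ₐ[ℂ] _).toAlgHom.comp <|
    lift (repGen t l)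
      (by
        have ht : (t : ℂ) ≠ 0 := by exact_mod_cast NeZero.ne t
        simp only [repGen, Matrix.diagonal_mul_diagonal, ← zpow_add₀ ht]
        simp)
      (by
        have ht : (t : ℂ) ≠ 0 := by exact_mod_cast NeZero.ne t
        simp only [repGen, Matrix.diagonal_mul_diagonal, ← zpow_add₀ ht]
        simp)
      (by
        have ht : (t : ℂ) ≠ 0 := by exact_mod_cast NeZero.ne t
        ext p m
        simp only [repGen, Matrix.diagonal_mul, Matrix.mul_diagonal, Matrix.smul_apply,
          Matrix.of_apply]
        split_ifs with h
        · rw [h, mul_add, zpow_add₀ ht, smul_eq_mul]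
          norm_cast
          ring
        · simp)
      (by
        have ht : (t : ℂ) ≠ 0 := by exact_mod_cast NeZero.ne t
        ext p m
        simp only [repGen, Matrix.diagonal_mul, Matrix.mul_diagonal, Matrix.smul_apply,
          Matrix.of_apply]
        split_ifs with h
        · rw [h, mul_sub, zpow_sub₀ ht, smul_eq_mul]
          norm_cast
          ring
        · simp)
      (by
        have ht : (t : ℂ) ≠ 0 := by exact_mod_cast NeZero.ne t
        rw [repGen_e_mul_f, repGen_f_mul_e]
        ext p m
        by_cases hpm : p = m
        · subst hpm
          simp only [repGen, pow_two (Matrix.diagonal _), Matrix.diagonal_mul_diagonal,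
            Matrix.sub_apply, Matrix.smul_apply, Matrix.diagonal_apply_eq, ← zpow_add₀ ht]
          rw [← Complex.ofReal_sub, qInt_identity]
          push_cast
          rw [smul_eq_mul]
          congr 3 <;> ring
        · simp [repGen, pow_two (Matrix.diagonal _), Matrix.diagonal_mul_diagonal, hpm])

/-! ## The elements -/

/-- The elements `λ_m^l = ([l+m]! / ([2l]! [l-m]!))^{1/2} ad_{f^{l-m}} (e^l k^{-l})`,
for `-l ≤ m ≤ l`. -/
noncomputable def lam (t : ℝ) [NeZero t] (l : ℕ) (m : Weight l) : U t :=
  (Real.sqrt (qFact t (l + m : ℤ).toNat / (qFact t (2 * l) * qFact t (l - m : ℤ).toNat)) : ℂ) •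
    HopfRep.ad (f t ^ (l - m : ℤ).toNat) (e t ^ l * kinv t ^ l)

/-- The vector `∑ c_{mn} e_m^j ⊗ e_n^i` of `V j ⊗ V i`. -/
noncomputable def coupledVec {j i : ℕ} (c : Weight j → Weight i → ℂ) : V j ⊗[ℂ] V i :=
  ∑ m, ∑ n, c m n • (vec m ⊗ₜ[ℂ] vec n)

/-- `c m n` is a Clebsch-Gordan coefficient `(jm, in | 00)_t`: the vector
`e_0^0 = ∑ c_{mn} e_m^j ⊗ e_n^i` is invariant, and it spans the isotypic component of the trivial
representation in a decomposition of `V j ⊗ V i` into subrepresentations, in which the component of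
`e_m^j ⊗ e_n^i` is `c_{mn} e_0^0`. This determines `c` up to a sign. -/
def IsTrivialClebschGordan (t : ℝ) [NeZero t] (j i : ℕ) (c : Weight j → Weight i → ℂ) : Prop :=
  coupledVec c ∈ HopfRep.invariants (HopfRep.tensorRep (rep t j) (rep t i)).toLinearMap ∧
  ∃ W : Submodule ℂ (V j ⊗[ℂ] V i),
    (∀ a, ∀ w ∈ W, HopfRep.tensorRep (rep t j) (rep t i) a w ∈ W) ∧
    IsCompl (ℂ ∙ coupledVec c) W ∧
    W ⊓ HopfRep.invariants (HopfRep.tensorRep (rep t j) (rep t i)).toLinearMap = ⊥ ∧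
    ∀ m n, vec m ⊗ₜ[ℂ] vec n - c m n • coupledVec c ∈ W

/-- The closed formula
`(jm, in | 00)_t = δ_{ji} δ_{m,-n} (-1)^{j-m} t^{-2m} / [2j+1]^{1/2}`. -/
noncomputable def clebschGordan (t : ℝ) (j i : ℕ) (m : Weight j) (n : Weight i) : ℂ :=
  if j = i ∧ (m : ℤ) = -(n : ℤ) then
    (((-1) ^ (j - m : ℤ) * t ^ (-(2 * (m : ℤ))) / Real.sqrt (qInt t (2 * j + 1)) : ℝ) : ℂ)
  else 0

/-- The element `C = ∑ c_{mn} λ_m^j λ_n^i` of `U t`. -/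
noncomputable def centralElt (t : ℝ) [NeZero t] {j i : ℕ} (c : Weight j → Weight i → ℂ) : U t :=
  ∑ m, ∑ n, c m n • (lam t j m * lam t i n)

end QuantumSU2

namespace QuantumSU2

open HopfRep

/-! ### The adjoint action: module algebra structure, invariants, and the submodule generated by
`e^l k^{-l}`. -/

section Adjoint

variable {t : ℝ} [NeZero t]

/-! The algebra `U` is a module algebra under `ad`: multiplication `U ⊗ U → U` intertwines the
tensor product of two adjoint actions with `ad` (`ad_e_mul`, `ad_f_mul`, `ad_k_mul`, `ad_kinv_mul`).
The vector `e^l k^{-l}` has weight `l`, is killed by `ad_e`, and is killed by `ad_f^{2l+1}`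
(`ad_f_pow_highest`), so the normalized vectors `λ^l_m` transform exactly as the `e^l_m`, and
`lamMap : V l → U` is an intertwiner (`lamMap_rep_gen`). Hence `C` is the image of the invariant
vector `e^0_0` under the intertwiner `V j ⊗ V i → U`. It is therefore `ad`-invariant
(`centralElt_mem_invariants`), and an `ad`-invariant element commutes with the generators
(`mem_center_of_mem_invariants_ad`).

Invariant vectors of `V j ⊗ V i` are found by coordinates. Since `t²` is a positive real different
from `1`, invariance under `k` leaves only the coordinates `(p, -p)`, and invariance under `e` gives
a two-term recursion in `p`. For `j ≠ i` its boundary conditions force `0`; for `j = i` the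
solutions form the line of the closed formula. The complement `W` is the kernel of the bilinear
pairing with the closed formula, which is an invariant functional taking the value `1` on the
closed-formula vector.

For `C ≠ 0` with `j = i = l`, `C` is evaluated in `π^l` itself, where `e* = f` and `k* = k`. There
`π(λ_{-m})` is a multiple of `π(λ_m)*`, with a factor whose dependence on `m` is exactly cancelled
by the sign and power of `t` in the Clebsch–Gordan coefficient. So `π(C)` is a non-zero multiple of
`∑ π(λ_m) π(λ_m)*`, whose trace is positive because `π(λ_l) ≠ 0`. -/

theorem comul_gen (x : Gen) : Coalgebra.comul (R := ℂ) (gen t x) = comulGen t x := by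
  change comulHom t (gen t x) = _
  simp [comulHom]

theorem counit_gen (x : Gen) : Coalgebra.counit (R := ℂ) (gen t x) = counitGen x := by
  change counitHom t (gen t x) = _
  simp [counitHom]

theorem antipode_gen (x : Gen) : HopfAlgebra.antipode ℂ (gen t x) = antipodeGen t x :=
  antipodeLin_gen t x

theorem antipode_mul' (a b : U t) : HopfAlgebra.antipode ℂ (a * b) =
    HopfAlgebra.antipode ℂ b * HopfAlgebra.antipode ℂ a :=
  antipodeLin_mul t a b

/-- The map sending `x ⊗ y` to `b ↦ x b S(y)` is multiplicative because `S` reverses products, and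
so is the comultiplication. -/
theorem ad_mul (a b : U t) : ad (a * b) = ad a * ad b := by
  have key : ∀ z w : U t ⊗[ℂ] U t,
      TensorProduct.lift ((LinearMap.mul ℂ (Module.End ℂ (U t))).compl₁₂ (LinearMap.mul ℂ (U t))
        ((LinearMap.mul ℂ (U t)).flip ∘ₗ HopfAlgebra.antipode ℂ)) (z * w) =
      TensorProduct.lift ((LinearMap.mul ℂ (Module.End ℂ (U t))).compl₁₂ (LinearMap.mul ℂ (U t))
        ((LinearMap.mul ℂ (U t)).flip ∘ₗ HopfAlgebra.antipode ℂ)) z *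
      TensorProduct.lift ((LinearMap.mul ℂ (Module.End ℂ (U t))).compl₁₂ (LinearMap.mul ℂ (U t))
        ((LinearMap.mul ℂ (U t)).flip ∘ₗ HopfAlgebra.antipode ℂ)) w := by
    intro z w
    induction z with
    | zero => simp
    | add x y hx hy => simp only [add_mul, map_add, hx, hy]
    | tmul p q =>
      induction w with
      | zero => simp
      | add x y hx hy => simp only [mul_add, map_add, hx, hy]
      | tmul r s =>
        ext b
        simp [antipode_mul', mul_assoc]
  simp only [ad, LinearMap.comp_apply, Bialgebra.comul_mul, key]

theorem ad_algebraMap (c : ℂ) : ad (algebraMap ℂ (U t) c) = algebraMap ℂ _ c := by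
  have h1 : ad (1 : U t) = 1 := by
    ext b
    have hone : HopfAlgebra.antipode ℂ (1 : U t) = 1 := by
      simp
    simp [ad, Algebra.TensorProduct.one_def, hone]
  rw [Algebra.algebraMap_eq_smul_one, map_smul, h1, Algebra.algebraMap_eq_smul_one]

theorem ad_pow (a : U t) (n : ℕ) : ad (a ^ n) = ad a ^ n := by
  induction n with
  | zero => simpa using ad_algebraMap (t := t) 1
  | succ n ih => rw [pow_succ, ad_mul, ih, pow_succ]

theorem ad_e_apply (b : U t) :
    ad (e t) b = e t * b * k t - ((t : ℂ) ^ 2)⁻¹ • (k t * b * e t) := by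
  simp [ad, comul_gen, comulGen, antipode_gen, antipodeGen, mul_assoc, sub_eq_add_neg]

theorem ad_f_apply (b : U t) :
    ad (f t) b = f t * b * k t - (t : ℂ) ^ 2 • (k t * b * f t) := by
  simp [ad, comul_gen, comulGen, antipode_gen, antipodeGen, mul_assoc, sub_eq_add_neg]

theorem ad_k_apply (b : U t) : ad (k t) b = k t * b * kinv t := by
  simp [ad, comul_gen, comulGen, antipode_gen, antipodeGen, mul_assoc]

theorem ad_kinv_apply (b : U t) : ad (kinv t) b = kinv t * b * k t := by
  simp [ad, comul_gen, comulGen, antipode_gen, antipodeGen, mul_assoc]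

theorem ad_k_mul (y z : U t) : ad (k t) (y * z) = ad (k t) y * ad (k t) z := by
  simp only [ad_k_apply]
  rw [show k t * y * kinv t * (k t * z * kinv t) = k t * y * (kinv t * k t) * z * kinv t by
    simp only [mul_assoc], kinv_k]
  simp [mul_assoc]

theorem ad_kinv_mul (y z : U t) : ad (kinv t) (y * z) = ad (kinv t) y * ad (kinv t) z := by
  simp only [ad_kinv_apply]
  rw [show kinv t * y * k t * (kinv t * z * k t) = kinv t * y * (k t * kinv t) * z * k t by
    simp only [mul_assoc], k_kinv]
  simp [mul_assoc]

omit [NeZero t] in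
theorem mul_kinv_mul_k (y : U t) : y * kinv t * k t = y := by rw [mul_assoc, kinv_k, mul_one]
omit [NeZero t] in
theorem mul_k_mul_kinv (y : U t) : y * k t * kinv t = y := by rw [mul_assoc, k_kinv, mul_one]

theorem kinv_e : kinv t * e t = ((t : ℂ) ^ 2)⁻¹ • (e t * kinv t) := by
  rw [e_kinv, smul_smul, inv_mul_cancel₀ (sq_ne_zero' t), one_smul]

theorem kinv_f : kinv t * f t = (t : ℂ) ^ 2 • (f t * kinv t) := by
  rw [f_kinv, smul_smul, mul_inv_cancel₀ (sq_ne_zero' t), one_smul]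

/-- The coproduct of `e` acting on a product. The two cross terms on the right cancel after `k⁻¹` is
moved past `e`. -/
theorem ad_e_mul (y z : U t) :
    ad (e t) (y * z) = ad (e t) y * ad (kinv t) z + ad (k t) y * ad (e t) z := by
  simp only [ad_e_apply, ad_k_apply, ad_kinv_apply, mul_sub, sub_mul, smul_mul_assoc,
    mul_smul_comm, ← mul_assoc, mul_kinv_mul_k, mul_k_mul_kinv]
  have : k t * y * kinv t * e t * z * k t =
      ((t : ℂ) ^ 2)⁻¹ • (k t * y * e t * kinv t * z * k t) := by
    rw [mul_assoc (k t * y), kinv_e]; simp [mul_assoc]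
  rw [this]
  abel

theorem ad_f_mul (y z : U t) :
    ad (f t) (y * z) = ad (f t) y * ad (kinv t) z + ad (k t) y * ad (f t) z := by
  simp only [ad_f_apply, ad_k_apply, ad_kinv_apply, mul_sub, sub_mul, smul_mul_assoc,
    mul_smul_comm, ← mul_assoc, mul_kinv_mul_k, mul_k_mul_kinv]
  have : k t * y * kinv t * f t * z * k t =
      (t : ℂ) ^ 2 • (k t * y * f t * kinv t * z * k t) := by
    rw [mul_assoc (k t * y), kinv_f]; simp [mul_assoc]
  rw [this]
  abel

/-- An element fixed by `ad` of the generators is invariant. -/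
theorem mem_invariants_ad {C : U t} (h : ∀ x, ad (gen t x) C = counitGen x • C) :
    C ∈ invariants (ad : U t →ₗ[ℂ] Module.End ℂ (U t)) := by
  intro a
  induction a using induction with
  | hgen x => rw [h, counit_gen]
  | hc c => rw [ad_algebraMap, Bialgebra.counit_algebraMap]; simp
  | hadd a b ha hb => rw [map_add, map_add, LinearMap.add_apply, ha, hb, add_smul]
  | hmul a b ha hb =>
    rw [ad_mul, Bialgebra.counit_mul, Module.End.mul_apply, hb, map_smul, ha, smul_smul, mul_comm]

/-- Invariance under `k` says that `C` commutes with `k`; then `ad_e C = 0` becomes `e C k = C e k`,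
and `k` can be cancelled. The same works for `f`. -/
theorem mem_center_of_mem_invariants_ad {C : U t}
    (hC : C ∈ invariants (ad : U t →ₗ[ℂ] Module.End ℂ (U t))) :
    C ∈ Subalgebra.center ℂ (U t) := by
  have h := sq_ne_zero' t
  have hg (x : Gen) : ad (gen t x) C = counitGen x • C := by rw [hC, counit_gen]
  have hk : k t * C = C * k t := by
    have := congrArg (· * k t) (hg .k)
    simpa [ad_k_apply, counitGen, mul_kinv_mul_k] using this
  have hki : kinv t * C = C * kinv t := by
    have := congrArg (· * kinv t) (hg .kinv)
    simpa [ad_kinv_apply, counitGen, mul_k_mul_kinv] using this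
  have cancel {x y : U t} (hxy : x * k t = y * k t) : x = y := by
    have := congrArg (· * kinv t) hxy
    simpa [mul_k_mul_kinv] using this
  have he : e t * C = C * e t := by
    have h1 := hg .e
    simp only [ad_e_apply, counitGen, zero_smul, sub_eq_zero] at h1
    rw [hk, mul_assoc C, k_e, mul_smul_comm, smul_smul, inv_mul_cancel₀ h, one_smul,
      ← mul_assoc] at h1
    exact cancel h1
  have hf : f t * C = C * f t := by
    have h1 := hg .f
    simp only [ad_f_apply, counitGen, zero_smul, sub_eq_zero] at h1
    rw [hk, mul_assoc C, k_f, mul_smul_comm, smul_smul, mul_inv_cancel₀ h, one_smul,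
      ← mul_assoc] at h1
    exact cancel h1
  rw [Subalgebra.mem_center_iff]
  intro a
  induction a using induction with
  | hgen x => cases x <;> assumption
  | hc c => exact Algebra.commutes c C
  | hadd a b ha hb => rw [add_mul, mul_add, ha, hb]
  | hmul a b ha hb => rw [mul_assoc, hb, ← mul_assoc, ha, mul_assoc]

/-! ### Weight vectors and the adjoint action of powers of `f` -/

variable (t) in
/-- `y` is a vector of weight `w` for the adjoint action. -/
def HasWeight (w : ℤ) (y : U t) : Prop :=
  ad (k t) y = (t : ℂ) ^ (2 * w) • y ∧ ad (kinv t) y = (t : ℂ) ^ (-(2 * w)) • y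

theorem ofReal_ne_zero' : (t : ℂ) ≠ 0 := by exact_mod_cast NeZero.ne t

theorem HasWeight.ad_f {w : ℤ} {y : U t} (h : HasWeight t w y) :
    HasWeight t (w - 1) (ad (f t) y) := by
  have ht : (t : ℂ) ≠ 0 := ofReal_ne_zero'
  constructor
  · rw [← Module.End.mul_apply, ← ad_mul, k_f, map_smul, ad_mul, LinearMap.smul_apply,
      Module.End.mul_apply, h.1, map_smul, smul_smul]
    congr 1
    rw [mul_sub, zpow_sub₀ ht]
    norm_cast
    ring
  · rw [← Module.End.mul_apply, ← ad_mul, kinv_f, map_smul, ad_mul, LinearMap.smul_apply,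
      Module.End.mul_apply, h.2, map_smul, smul_smul]
    congr 1
    rw [show -(2 * (w - 1)) = 2 + -(2 * w) by ring, zpow_add₀ ht]
    norm_cast

theorem HasWeight.ad_f_pow {w : ℤ} {y : U t} (h : HasWeight t w y) (n : ℕ) :
    HasWeight t (w - n) ((ad (f t) ^ n) y) := by
  induction n with
  | zero => simpa using h
  | succ n ih =>
    rw [pow_succ', Module.End.mul_apply, Nat.cast_succ, ← sub_sub]
    exact ih.ad_f

theorem HasWeight.mul {w w' : ℤ} {y z : U t} (hy : HasWeight t w y) (hz : HasWeight t w' z) :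
    HasWeight t (w + w') (y * z) := by
  have ht : (t : ℂ) ≠ 0 := ofReal_ne_zero'
  constructor
  · rw [ad_k_mul, hy.1, hz.1, smul_mul_smul_comm, mul_add, zpow_add₀ ht]
  · rw [ad_kinv_mul, hy.2, hz.2, smul_mul_smul_comm, mul_add, neg_add, zpow_add₀ ht]

theorem HasWeight.smul {w : ℤ} {y : U t} (hy : HasWeight t w y) (c : ℂ) :
    HasWeight t w (c • y) := by
  constructor
  · rw [map_smul, hy.1, smul_comm]
  · rw [map_smul, hy.2, smul_comm]

/-- If `y`, `z` are annihilated by the powers `p + 1`, `q + 1` of `ad_f`, the power `p + q` maps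
`y * z` to a multiple of the product of the lowest vectors. -/
theorem exists_ad_f_pow_mul (p q : ℕ) {w w' : ℤ} {y z : U t} (hy : HasWeight t w y)
    (hz : HasWeight t w' z) (hp : (ad (f t) ^ (p + 1)) y = 0) (hq : (ad (f t) ^ (q + 1)) z = 0) :
    ∃ s : ℂ, (ad (f t) ^ (p + q)) (y * z) = s • ((ad (f t) ^ p) y * (ad (f t) ^ q) z) := by
  induction hn : p + q generalizing p q w w' y z with
  | zero =>
    obtain ⟨rfl, rfl⟩ : p = 0 ∧ q = 0 := by omega
    exact ⟨1, by simp⟩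
  | succ n ih =>
    have h1 : ∃ s : ℂ, (ad (f t) ^ n) (ad (f t) y * z) =
        s • ((ad (f t) ^ p) y * (ad (f t) ^ q) z) := by
      rcases p with _ | p
      · refine ⟨0, ?_⟩
        rw [zero_add, pow_one] at hp
        simp [hp]
      · obtain ⟨s, hs⟩ := ih p q hy.ad_f hz (by rw [← Module.End.mul_apply, ← pow_succ, hp]) hq
          (by omega)
        exact ⟨s, by rw [hs, pow_succ (ad (f t)) p, Module.End.mul_apply]⟩
    have h2 : ∃ s : ℂ, (ad (f t) ^ n) (y * ad (f t) z) =
        s • ((ad (f t) ^ p) y * (ad (f t) ^ q) z) := by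
      rcases q with _ | q
      · refine ⟨0, ?_⟩
        rw [zero_add, pow_one] at hq
        simp [hq]
      · obtain ⟨s, hs⟩ := ih p q hy hz.ad_f hp (by rw [← Module.End.mul_apply, ← pow_succ, hq])
          (by omega)
        exact ⟨s, by rw [hs, pow_succ (ad (f t)) q, Module.End.mul_apply]⟩
    obtain ⟨s₁, h1⟩ := h1
    obtain ⟨s₂, h2⟩ := h2
    -- On weight vectors `ad_k` and `ad_{k⁻¹}` are scalars, so one application of `ad_f` yields a
    -- combination of `(ad_f y) z` and `y (ad_f z)`.
    rw [pow_succ, Module.End.mul_apply, ad_f_mul, hz.2, hy.1, mul_smul_comm, smul_mul_assoc,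
      map_add, map_smul, map_smul, h1, h2, smul_smul, smul_smul, ← add_smul]
    exact ⟨_, rfl⟩

theorem ad_f_pow_mul_eq_zero (p q : ℕ) {w w' : ℤ} {y z : U t} (hy : HasWeight t w y)
    (hz : HasWeight t w' z) (hp : (ad (f t) ^ (p + 1)) y = 0) (hq : (ad (f t) ^ (q + 1)) z = 0) :
    (ad (f t) ^ (p + q + 1)) (y * z) = 0 := by
  obtain ⟨s, hs⟩ := exists_ad_f_pow_mul p q hy hz hp hq
  rw [pow_succ', Module.End.mul_apply] at hp hq ⊢
  rw [hs, map_smul, ad_f_mul, hp, hq]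
  simp

/-! ### The highest weight vectors `e^l k^{-l}` -/

theorem hasWeight_one : HasWeight t 0 (1 : U t) := by
  constructor
  · simp [ad_k_apply, k_kinv]
  · simp [ad_kinv_apply, kinv_k]

theorem hasWeight_e_mul_kinv : HasWeight t 1 (e t * kinv t) := by
  have h := sq_ne_zero' t
  constructor
  · rw [ad_k_apply, ← mul_assoc, k_e, smul_mul_assoc, mul_k_mul_kinv, smul_mul_assoc]
    norm_cast
  · rw [ad_kinv_apply, ← mul_assoc, mul_kinv_mul_k, e_kinv, smul_smul, zpow_neg]
    norm_cast at h ⊢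
    rw [inv_mul_cancel₀ (by simpa using h)]; simp

theorem kinv_mul_e_pow (l : ℕ) :
    kinv t * e t ^ l = (((t : ℂ) ^ 2)⁻¹ ^ l) • (e t ^ l * kinv t) := by
  induction l with
  | zero => simp
  | succ l ih =>
    rw [pow_succ, ← mul_assoc, ih, smul_mul_assoc, mul_assoc, kinv_e, mul_smul_comm, smul_smul,
      pow_succ _ l, mul_assoc]

/-- Reduces statements about the highest weight vectors to the case `l = 1` by induction on
products. -/
theorem e_pow_mul_kinv_pow_succ (l : ℕ) : e t ^ (l + 1) * kinv t ^ (l + 1) =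
    ((t : ℂ) ^ 2) ^ l • (e t * kinv t * (e t ^ l * kinv t ^ l)) := by
  have h := sq_ne_zero' t
  rw [mul_assoc (e t), ← mul_assoc (kinv t), kinv_mul_e_pow, smul_mul_assoc, mul_smul_comm,
    smul_smul, ← mul_pow, mul_inv_cancel₀ h, one_pow, one_smul, pow_succ' (e t), pow_succ' (kinv t)]
  simp only [mul_assoc]

theorem hasWeight_highest (l : ℕ) : HasWeight t l (e t ^ l * kinv t ^ l) := by
  induction l with
  | zero => simpa using hasWeight_one
  | succ l ih =>
    rw [e_pow_mul_kinv_pow_succ, Nat.cast_succ, add_comm]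
    exact (hasWeight_e_mul_kinv.mul ih).smul _

theorem ad_e_highest (l : ℕ) : ad (e t) (e t ^ l * kinv t ^ l) = 0 := by
  have h := sq_ne_zero' t
  induction l with
  | zero => simp [ad_e_apply, k_e, smul_smul, inv_mul_cancel₀ h]
  | succ l ih =>
    have h1 : ad (e t) (e t * kinv t) = 0 := by
      rw [ad_e_apply, ← mul_assoc, mul_kinv_mul_k, ← mul_assoc, k_e, smul_mul_assoc,
        mul_k_mul_kinv, smul_mul_assoc, smul_smul, inv_mul_cancel₀ h, one_smul, sub_self]
    rw [e_pow_mul_kinv_pow_succ, map_smul, ad_e_mul, h1, ih]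
    simp

theorem f_k : f t * k t = (t : ℂ) ^ 2 • (k t * f t) := by
  rw [k_f, smul_smul, mul_inv_cancel₀ (sq_ne_zero' t), one_smul]

theorem exists_ad_f_sq : ∃ s : ℂ, (ad (f t) ^ 2) (e t * kinv t) = s • (kinv t * f t) := by
  have h := sq_ne_zero' t
  set q : ℂ := (t : ℂ) ^ 2 with hq
  set X : U t := f t * e t - q ^ 2 • (e t * f t) with hX
  have h1 : ad (f t) (e t * kinv t) = X := by
    rw [ad_f_apply, ← mul_assoc, mul_kinv_mul_k, ← mul_assoc, k_e, smul_mul_assoc,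
      mul_k_mul_kinv, smul_mul_assoc, smul_smul, ← pow_two]
  have hkX : k t * X = X * k t := by
    have hfe : k t * (f t * e t) = f t * e t * k t := by
      rw [← mul_assoc, k_f, smul_mul_assoc, mul_assoc (f t), k_e, mul_smul_comm, smul_smul,
        inv_mul_cancel₀ h, one_smul, mul_assoc]
    have hef : k t * (e t * f t) = e t * f t * k t := by
      rw [← mul_assoc, k_e, smul_mul_assoc, mul_assoc (e t), k_f, mul_smul_comm, smul_smul,
        mul_inv_cancel₀ h, one_smul, mul_assoc]
    rw [hX, mul_sub, sub_mul, mul_smul_comm, smul_mul_assoc, hfe, hef]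
  have h2 : ad (f t) X = (f t * X - X * f t) * k t := by
    rw [ad_f_apply, hkX, mul_assoc X, k_f, mul_smul_comm, smul_smul, mul_inv_cancel₀ h, one_smul,
      sub_mul (f t * X), mul_assoc X]
  have h3 : f t * X - X * f t = q ^ 2 • ((e t * f t - f t * e t) * f t) -
      f t * (e t * f t - f t * e t) := by
    simp only [hX, mul_sub, sub_mul, mul_smul_comm, smul_mul_assoc, smul_sub, mul_assoc]
    abel
  have hkk : k t ^ 2 * f t = (q⁻¹ ^ 2) • (f t * k t ^ 2) := by
    rw [pow_two, mul_assoc, k_f, mul_smul_comm, ← mul_assoc, k_f, smul_mul_assoc, smul_smul,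
      ← pow_two, mul_assoc]
  have hkiki : kinv t ^ 2 * f t = (q ^ 2) • (f t * kinv t ^ 2) := by
    rw [pow_two, mul_assoc, kinv_f, mul_smul_comm, ← mul_assoc, kinv_f, smul_mul_assoc, smul_smul,
      ← pow_two, mul_assoc]
  -- The `k²` contributions cancel: moving `f` past `k²` costs `q⁻²`, which the factor `q²` in `X`
  -- compensates. Only the `k⁻²` terms survive.
  have h4 : f t * X - X * f t = ((q - q⁻¹)⁻¹ * (1 - q ^ 4)) • (f t * kinv t ^ 2) := by
    rw [h3, e_f, smul_mul_assoc, mul_smul_comm, sub_mul, hkk, hkiki, smul_comm, ← smul_sub,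
      mul_smul, mul_sub]
    congr 1
    rw [smul_sub, smul_smul, smul_smul, ← mul_pow, mul_inv_cancel₀ h, one_pow, one_smul, sub_smul,
      one_smul, show q ^ 4 = q ^ 2 * q ^ 2 by ring]
    abel
  refine ⟨(q - q⁻¹)⁻¹ * (1 - q ^ 4) * q⁻¹, ?_⟩
  rw [pow_two, Module.End.mul_apply, h1, h2, h4, smul_mul_assoc, pow_two (kinv t),
    ← mul_assoc, mul_kinv_mul_k, f_kinv, smul_smul]

theorem ad_f_kinv_mul_f : ad (f t) (kinv t * f t) = 0 := by
  rw [ad_f_apply, ← mul_assoc (k t), k_kinv, one_mul, mul_assoc (f t), mul_assoc (kinv t), f_k,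
    mul_smul_comm, ← mul_assoc (kinv t), kinv_k, one_mul, mul_smul_comm, sub_self]

theorem ad_f_pow_three : (ad (f t) ^ 3) (e t * kinv t) = 0 := by
  obtain ⟨s, hs⟩ := exists_ad_f_sq (t := t)
  rw [pow_succ', Module.End.mul_apply, hs, map_smul, ad_f_kinv_mul_f, smul_zero]

omit [NeZero t] in
theorem f_mul_kinv_pow (l : ℕ) :
    f t * kinv t ^ l = ((t : ℂ) ^ 2)⁻¹ ^ l • (kinv t ^ l * f t) := by
  induction l with
  | zero => simp
  | succ l ih =>
    rw [pow_succ, ← mul_assoc, ih, smul_mul_assoc, mul_assoc, f_kinv, mul_smul_comm, smul_smul,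
      pow_succ _ l, mul_assoc]

/-- The `ad_f`-strings of `e k⁻¹` and `e^l k^{-l}` end after `2` and `2l` steps, and these lengths
add for the product. The scalar `s` is not computed; that it is non-zero comes later from the
representation `π^l`. -/
theorem ad_f_pow_highest (l : ℕ) : (ad (f t) ^ (2 * l + 1)) (e t ^ l * kinv t ^ l) = 0 ∧
    ∃ s : ℂ, (ad (f t) ^ (2 * l)) (e t ^ l * kinv t ^ l) = s • (kinv t ^ l * f t ^ l) := by
  induction l with
  | zero =>
    refine ⟨?_, 1, by simp⟩
    simp [ad_f_apply, f_k]
  | succ l ih =>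
    obtain ⟨hl, s, hs⟩ := ih
    obtain ⟨s₁, hs₁⟩ := exists_ad_f_sq (t := t)
    rw [e_pow_mul_kinv_pow_succ, map_smul, map_smul]
    constructor
    · have := ad_f_pow_mul_eq_zero 2 (2 * l) hasWeight_e_mul_kinv (hasWeight_highest l)
        ad_f_pow_three hl
      rw [show 2 * (l + 1) + 1 = 2 + 2 * l + 1 by ring, this, smul_zero]
    · obtain ⟨s₂, hs₂⟩ := exists_ad_f_pow_mul 2 (2 * l) hasWeight_e_mul_kinv (hasWeight_highest l)
        ad_f_pow_three hl
      rw [show 2 * (l + 1) = 2 + 2 * l by ring, hs₂, hs, hs₁, smul_mul_smul_comm, mul_assoc,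
        ← mul_assoc (f t), f_mul_kinv_pow, smul_mul_assoc, mul_smul_comm, smul_smul, smul_smul,
        smul_smul, mul_assoc (kinv t ^ l), ← pow_succ', ← mul_assoc (kinv t), ← pow_succ']
      exact ⟨_, rfl⟩

end Adjoint

/-! ### Positivity of quantum integers, and the intertwiner from `V l` to the adjoint submodule. -/

section Representation

variable {t : ℝ}

theorem sq_sub_inv_ne_zero [NeZero t] (ht : t ^ 2 ≠ 1) : t ^ 2 - (t ^ 2)⁻¹ ≠ 0 := by
  have h : 0 < t ^ 2 := by have := NeZero.ne t; positivity
  intro h0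
  have h1 := mul_inv_cancel₀ h.ne'
  rw [← sub_eq_zero.1 h0] at h1
  exact ht (by nlinarith)

/-- A positive real other than `1` is not a root of unity, so `k` separates the weights. -/
theorem zpow_two_mul_eq_one [NeZero t] (ht : t ^ 2 ≠ 1) {n : ℤ} (hn : t ^ (2 * n) = 1) : n = 0 := by
  have h : 0 ≤ t ^ 2 := by positivity
  have h1 : (t ^ 2) ^ n = 1 := by rw [zpow_mul] at hn; exact_mod_cast hn
  by_contra h0
  rcases (zpow_eq_one_iff_of_ne_zero₀ h0).1 h1 with h2 | ⟨h2, -⟩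
  · exact ht h2
  · linarith

theorem qInt_pos [NeZero t] (ht : t ^ 2 ≠ 1) {n : ℤ} (hn : 0 < n) : 0 < qInt t n := by
  refine lt_of_le_of_ne (qInt_nonneg t hn.le) (Ne.symm ?_)
  have h0 : t ≠ 0 := NeZero.ne t
  refine div_ne_zero ?_ (sq_sub_inv_ne_zero ht)
  rw [sub_ne_zero]
  intro h
  have h1 : t ^ (2 * (2 * n)) = 1 := by
    rw [show 2 * (2 * n) = 2 * n + 2 * n by ring, zpow_add₀ h0]
    nth_rewrite 2 [h]
    rw [← zpow_add₀ h0]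
    simp
  have := zpow_two_mul_eq_one ht h1
  omega

theorem qInt_zero : qInt t 0 = 0 := by simp [qInt]

theorem qFact_pos [NeZero t] (ht : t ^ 2 ≠ 1) (n : ℕ) : 0 < qFact t n :=
  Finset.prod_pos fun i _ => qInt_pos ht (by positivity)

theorem qFact_succ (n : ℕ) : qFact t (n + 1) = qFact t n * qInt t (n + 1) :=
  Finset.prod_range_succ _ _

variable (t) in
/-- The matrix coefficient `([l-p] [l+p+1])^{1/2}` between the weights `p` and `p + 1`. -/
noncomputable def step (l : ℕ) (p : ℤ) : ℂ := (Real.sqrt (qInt t (l - p) * qInt t (l + p + 1)) : ℂ)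

theorem step_neg (l : ℕ) (p : ℤ) : step t l (-p - 1) = step t l p := by
  unfold step
  rw [mul_comm]
  congr 4 <;> ring

/-- The matrix coefficients vanish at both edges, so the action formulas hold for all integer
weights when vectors outside the range are set to `0`. -/
theorem step_self (l : ℕ) : step t l l = 0 := by simp [step, qInt_zero]

theorem step_neg_self_sub_one (l : ℕ) : step t l (-l - 1) = 0 := by rw [step_neg, step_self]

theorem step_ne_zero [NeZero t] (ht : t ^ 2 ≠ 1) {l : ℕ} {p : ℤ} (h1 : -(l : ℤ) ≤ p) (h2 : p < l) :
    step t l p ≠ 0 := by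
  unfold step
  rw [Complex.ofReal_ne_zero, Real.sqrt_ne_zero']
  exact mul_pos (qInt_pos ht (by omega)) (qInt_pos ht (by omega))

/-- The weight vectors of `V l`, extended by zero to all integers. -/
noncomputable def vecZ (l : ℕ) (p : ℤ) : V l :=
  if h : p ∈ Finset.Icc (-(l : ℤ)) l then vec ⟨p, h⟩ else 0

theorem vecZ_coe {l : ℕ} (m : Weight l) : vecZ l m = vec m := by
  simp only [vecZ, m.2, dite_true]

theorem vecZ_of_notMem {l : ℕ} {p : ℤ} (h : p ∉ Finset.Icc (-(l : ℤ)) l) : vecZ l p = 0 := by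
  simp only [vecZ, h, dite_false]

theorem vecZ_apply {l : ℕ} (p : ℤ) (m : Weight l) : vecZ l p m = if (m : ℤ) = p then 1 else 0 := by
  unfold vecZ
  split_ifs with h h1 h1
  · subst h1; simp
  · exact Pi.single_eq_of_ne (fun h2 => h1 (by rw [h2])) 1
  · exact absurd (h1 ▸ m.2) h
  · rfl

variable [NeZero t]

variable (t) in
/-- The matrices of `rep t l` in the weight basis. -/
noncomputable def matRep (l : ℕ) : U t →ₐ[ℂ] Matrix (Weight l) (Weight l) ℂ :=
  (Matrix.toLinAlgEquiv'.symm : _ ≃ₐ[ℂ] Matrix (Weight l) (Weight l) ℂ).toAlgHom.comp (rep t l)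

theorem rep_apply (l : ℕ) (a : U t) (v : V l) : rep t l a v = (matRep t l a).mulVec v := by
  rw [← Matrix.toLinAlgEquiv'_apply]
  simp [matRep]

theorem matRep_gen (l : ℕ) (x : Gen) : matRep t l (gen t x) = repGen t l x := by
  have : rep t l (gen t x) = Matrix.toLinAlgEquiv' (repGen t l x) := by
    simp [rep]
  simp [matRep, this]

theorem rep_gen_vec_apply (l : ℕ) (x : Gen) (m p : Weight l) :
    rep t l (gen t x) (vec m) p = repGen t l x p m := by
  rw [rep_apply, matRep_gen]
  simp

theorem rep_e_vecZ (l : ℕ) (p : ℤ) : rep t l (e t) (vecZ l p) = step t l p • vecZ l (p + 1) := by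
  by_cases h : p ∈ Finset.Icc (-(l : ℤ)) l
  · lift p to Weight l using h
    ext m
    rw [vecZ_coe, rep_gen_vec_apply, Pi.smul_apply, vecZ_apply]
    simp [repGen, step]
  · rw [vecZ_of_notMem h, map_zero]
    by_cases h1 : p + 1 ∈ Finset.Icc (-(l : ℤ)) l
    · have : p = -l - 1 := by
        rw [Finset.mem_Icc] at h h1; omega
      rw [this, step_neg_self_sub_one, zero_smul]
    · rw [vecZ_of_notMem h1, smul_zero]

theorem rep_f_vecZ (l : ℕ) (p : ℤ) :
    rep t l (f t) (vecZ l p) = step t l (p - 1) • vecZ l (p - 1) := by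
  by_cases h : p ∈ Finset.Icc (-(l : ℤ)) l
  · lift p to Weight l using h
    ext m
    rw [vecZ_coe, rep_gen_vec_apply, Pi.smul_apply, vecZ_apply]
    simp only [repGen, Matrix.of_apply, step, smul_eq_mul, mul_ite, mul_one, mul_zero]
    rw [show (l : ℤ) + (p - 1) + 1 = l + p by ring, show (l : ℤ) - (p - 1) = l - p + 1 by ring,
      mul_comm (qInt t _)]
  · rw [vecZ_of_notMem h, map_zero]
    by_cases h1 : p - 1 ∈ Finset.Icc (-(l : ℤ)) l
    · have : p - 1 = l := by
        rw [Finset.mem_Icc] at h h1; omega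
      rw [this, step_self, zero_smul]
    · rw [vecZ_of_notMem h1, smul_zero]

theorem rep_k_vecZ (l : ℕ) (p : ℤ) :
    rep t l (k t) (vecZ l p) = (t : ℂ) ^ (2 * p) • vecZ l p := by
  by_cases h : p ∈ Finset.Icc (-(l : ℤ)) l
  · lift p to Weight l using h
    ext m
    rw [vecZ_coe, rep_gen_vec_apply, Pi.smul_apply]
    by_cases hmp : m = p
    · subst hmp; simp [repGen]
    · simp [repGen, hmp]
  · rw [vecZ_of_notMem h, map_zero, smul_zero]

theorem rep_kinv_vecZ (l : ℕ) (p : ℤ) :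
    rep t l (kinv t) (vecZ l p) = (t : ℂ) ^ (-(2 * p)) • vecZ l p := by
  by_cases h : p ∈ Finset.Icc (-(l : ℤ)) l
  · lift p to Weight l using h
    ext m
    rw [vecZ_coe, rep_gen_vec_apply, Pi.smul_apply]
    by_cases hmp : m = p
    · subst hmp; simp [repGen]
    · simp [repGen, hmp]
  · rw [vecZ_of_notMem h, map_zero, smul_zero]

theorem V_hom_ext {l : ℕ} {M : Type*} [AddCommGroup M] [Module ℂ M] {φ ψ : V l →ₗ[ℂ] M}
    (h : ∀ p : ℤ, φ (vecZ l p) = ψ (vecZ l p)) : φ = ψ := by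
  refine (Pi.basisFun ℂ (Weight l)).ext fun m => ?_
  have := h m
  rw [vecZ_coe] at this
  simpa using this

/-! ### The elements `lam` form a copy of `V l` -/

/-- The usual `sl(2)` computation: `[e, f]` acts on weight `w` by a scalar, which `qInt_identity`
writes as a difference, and the sum over the string telescopes. -/
theorem ad_e_ad_f_pow (l n : ℕ) : ad (e t) ((ad (f t) ^ (n + 1)) (e t ^ l * kinv t ^ l)) =
    ((qInt t (n + 1) * qInt t (2 * l - n) : ℝ) : ℂ) • (ad (f t) ^ n) (e t ^ l * kinv t ^ l) := by
  have ht : (t : ℂ) ≠ 0 := ofReal_ne_zero'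
  have comm (w : ℤ) (z : U t) (hz : HasWeight t w z) : ad (e t) (ad (f t) z) =
      ad (f t) (ad (e t) z) + (((t ^ 2 - (t ^ 2)⁻¹)⁻¹ * (t ^ (4 * w) - t ^ (-(4 * w))) : ℝ) : ℂ) •
        z := by
    rw [← Module.End.mul_apply, ← ad_mul, ← sub_add_cancel (e t * f t) (f t * e t), e_f, map_add,
      LinearMap.add_apply, map_smul, LinearMap.smul_apply, map_sub, LinearMap.sub_apply, ad_mul,
      ad_pow, ad_pow, pow_two (ad (k t)), pow_two (ad (kinv t))]
    simp only [Module.End.mul_apply, hz.1, hz.2, map_smul, smul_smul, ← zpow_add₀ ht]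
    rw [← sub_smul, smul_smul, add_comm]
    push_cast
    congr 5 <;> ring
  induction n with
  | zero =>
    rw [zero_add, pow_one, pow_zero, Module.End.one_apply, comm _ _ (hasWeight_highest l),
      ad_e_highest, map_zero, zero_add, ← qInt_identity t l,
      sub_self, qInt_zero, Nat.cast_zero]
    congr 2
    ring_nf
  | succ n ih =>
    rw [pow_succ', Module.End.mul_apply, comm _ _ ((hasWeight_highest l).ad_f_pow (n + 1)), ih,
      map_smul, ← Module.End.mul_apply, ← pow_succ', ← add_smul, ← qInt_identity t l,
      ← Complex.ofReal_add]
    congr 2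
    push_cast
    ring_nf

variable (t) in
/-- The elements `lam t l m`, extended by zero to all integers. -/
noncomputable def lamZ (l : ℕ) (p : ℤ) : U t :=
  if h : p ∈ Finset.Icc (-(l : ℤ)) l then lam t l ⟨p, h⟩ else 0

theorem lamZ_coe {l : ℕ} (m : Weight l) : lamZ t l m = lam t l m := by
  simp only [lamZ, m.2, dite_true]

theorem lamZ_of_notMem {l : ℕ} {p : ℤ} (h : p ∉ Finset.Icc (-(l : ℤ)) l) : lamZ t l p = 0 := by
  simp only [lamZ, h, dite_false]

variable (t) in
/-- The normalization constant of `lamZ t l (l - n)`. -/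
noncomputable def lamCoeff (l n : ℕ) : ℝ :=
  Real.sqrt (qFact t (2 * l - n) / (qFact t (2 * l) * qFact t n))

theorem lamZ_sub {l n : ℕ} (hn : n ≤ 2 * l) : lamZ t l (l - n) =
    (lamCoeff t l n : ℂ) • (ad (f t) ^ n) (e t ^ l * kinv t ^ l) := by
  have h : (l : ℤ) - n ∈ Finset.Icc (-(l : ℤ)) l := Finset.mem_Icc.2 ⟨by omega, by omega⟩
  rw [lamZ, dif_pos h, lam, ad_pow, lamCoeff]
  have h1 : ((l : ℤ) - (l - n)).toNat = n := by omega
  have h2 : ((l : ℤ) + (l - n)).toNat = 2 * l - n := by omega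
  simp only [h1, h2]

/-- On the unnormalized string `ad_f` has coefficient `1` and `ad_e` has coefficient `[n+1] [2l-n]`.
The normalization gives both the square root of that product, as in `V l`. -/
theorem lamCoeff_succ (ht : t ^ 2 ≠ 1) {l n : ℕ} (hn : n < 2 * l) :
    (lamCoeff t l n : ℂ) = step t l (l - (n + 1)) * lamCoeff t l (n + 1) := by
  unfold lamCoeff step
  obtain ⟨r, hr⟩ : ∃ r, 2 * l - n = r + 1 := ⟨2 * l - n - 1, by omega⟩
  have hr' : 2 * l - (n + 1) = r := by omega
  have e1 : (l : ℤ) - (l - (n + 1)) = n + 1 := by ring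
  have e2 : (l : ℤ) + (l - (n + 1)) + 1 = r + 1 := by omega
  have hn1 : 0 < qInt t (n + 1) := qInt_pos ht (by positivity)
  have hr1 : 0 < qInt t (r + 1) := qInt_pos ht (by positivity)
  rw [← Complex.ofReal_mul, ← Real.sqrt_mul (by rw [e1, e2]; positivity), e1, e2, hr, hr',
    qFact_succ, qFact_succ]
  have := qFact_pos ht n
  have := qFact_pos ht (2 * l)
  congr 2
  field_simp

theorem step_mul_self {l : ℕ} {p : ℤ} (h1 : -(l : ℤ) ≤ p) (h2 : p < l) :
    step t l p * step t l p = ((qInt t (l - p) * qInt t (l + p + 1) : ℝ) : ℂ) :=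
  sqrt_mul_self_qInt t (by omega) (by omega)

theorem ad_e_lamZ (ht : t ^ 2 ≠ 1) (l : ℕ) (p : ℤ) :
    ad (e t) (lamZ t l p) = step t l p • lamZ t l (p + 1) := by
  by_cases h : p ∈ Finset.Icc (-(l : ℤ)) l
  · obtain ⟨n, hn, rfl⟩ : ∃ n : ℕ, n ≤ 2 * l ∧ p = l - n := by
      rw [Finset.mem_Icc] at h
      exact ⟨(l - p).toNat, by omega, by omega⟩
    rw [lamZ_sub hn, map_smul]
    rcases n with _ | n
    · simp [step_self, ad_e_highest]
    · rw [ad_e_ad_f_pow, show (l : ℤ) - (n + 1 : ℕ) + 1 = l - n by push_cast; ring,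
        lamZ_sub (by omega), lamCoeff_succ ht (n := n) (by omega), smul_smul, smul_smul,
        Nat.cast_succ, ← mul_assoc, step_mul_self (by omega) (by omega), mul_comm]
      congr 4 <;> congr 1 <;> ring
  · rw [lamZ_of_notMem h, map_zero]
    by_cases h1 : p + 1 ∈ Finset.Icc (-(l : ℤ)) l
    · have : p = -l - 1 := by
        rw [Finset.mem_Icc] at h h1; omega
      rw [this, step_neg_self_sub_one, zero_smul]
    · rw [lamZ_of_notMem h1, smul_zero]

theorem ad_f_lamZ (ht : t ^ 2 ≠ 1) (l : ℕ) (p : ℤ) :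
    ad (f t) (lamZ t l p) = step t l (p - 1) • lamZ t l (p - 1) := by
  by_cases h : p ∈ Finset.Icc (-(l : ℤ)) l
  · obtain ⟨n, hn, rfl⟩ : ∃ n : ℕ, n ≤ 2 * l ∧ p = l - n := by
      rw [Finset.mem_Icc] at h
      exact ⟨(l - p).toNat, by omega, by omega⟩
    rw [lamZ_sub hn, map_smul, ← Module.End.mul_apply, ← pow_succ']
    rcases hn.eq_or_lt with rfl | hn
    · rw [(ad_f_pow_highest l).1, smul_zero, show (l : ℤ) - (2 * l : ℕ) - 1 = -l - 1 by omega,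
        step_neg_self_sub_one, zero_smul]
    · rw [show (l : ℤ) - n - 1 = l - (n + 1 : ℕ) by omega, lamZ_sub (by omega),
        lamCoeff_succ ht hn, smul_smul, Nat.cast_succ]
  · rw [lamZ_of_notMem h, map_zero]
    by_cases h1 : p - 1 ∈ Finset.Icc (-(l : ℤ)) l
    · have : p - 1 = l := by
        rw [Finset.mem_Icc] at h h1; omega
      rw [this, step_self, zero_smul]
    · rw [lamZ_of_notMem h1, smul_zero]

theorem hasWeight_lamZ (l : ℕ) (p : ℤ) : HasWeight t p (lamZ t l p) := by
  by_cases h : p ∈ Finset.Icc (-(l : ℤ)) l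
  · obtain ⟨n, hn, rfl⟩ : ∃ n : ℕ, n ≤ 2 * l ∧ p = l - n := by
      rw [Finset.mem_Icc] at h
      exact ⟨(l - p).toNat, by omega, by omega⟩
    rw [lamZ_sub hn]
    exact ((hasWeight_highest l).ad_f_pow n).smul _
  · simp [lamZ_of_notMem h, HasWeight]

variable (t) in
/-- The linear map `V l → U t` that sends the weight basis to the elements `lam t l m`. -/
noncomputable def lamMap (l : ℕ) : V l →ₗ[ℂ] U t := (Pi.basisFun ℂ (Weight l)).constr ℂ (lam t l)

theorem lamMap_vec {l : ℕ} (m : Weight l) : lamMap t l (vec m) = lam t l m := by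
  have := (Pi.basisFun ℂ (Weight l)).constr_basis ℂ (lam t l) m
  rwa [Pi.basisFun_apply] at this

theorem lamMap_vecZ (l : ℕ) (p : ℤ) : lamMap t l (vecZ l p) = lamZ t l p := by
  unfold vecZ lamZ
  split_ifs
  · exact lamMap_vec _
  · exact map_zero _

theorem lamMap_rep_gen (ht : t ^ 2 ≠ 1) (l : ℕ) (x : Gen) (v : V l) :
    lamMap t l (rep t l (gen t x) v) = ad (gen t x) (lamMap t l v) := by
  suffices h : lamMap t l ∘ₗ rep t l (gen t x) = ad (gen t x) ∘ₗ lamMap t l from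
    LinearMap.congr_fun h v
  refine V_hom_ext fun p => ?_
  simp only [LinearMap.comp_apply, lamMap_vecZ]
  cases x
  · rw [rep_e_vecZ, map_smul, lamMap_vecZ, ad_e_lamZ ht]
  · rw [rep_f_vecZ, map_smul, lamMap_vecZ, ad_f_lamZ ht]
  · rw [rep_k_vecZ, map_smul, lamMap_vecZ, (hasWeight_lamZ l p).1]
  · rw [rep_kinv_vecZ, map_smul, lamMap_vecZ, (hasWeight_lamZ l p).2]

/-- The product of the copies of `V j` and `V i` in `U t`. -/
theorem mul_lamMap_tensorRep (ht : t ^ 2 ≠ 1) (j i : ℕ) (x : Gen) (w : V j ⊗[ℂ] V i) :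
    LinearMap.mul' ℂ (U t) (TensorProduct.map (lamMap t j) (lamMap t i)
      (tensorRep (rep t j) (rep t i) (gen t x) w)) =
    ad (gen t x) (LinearMap.mul' ℂ (U t) (TensorProduct.map (lamMap t j) (lamMap t i) w)) := by
  induction w with
  | zero => simp
  | add v w hv hw => simp only [map_add, hv, hw]
  | tmul v w =>
    have hc : Bialgebra.comulAlgHom ℂ (U t) (gen t x) = comulGen t x := comul_gen x
    simp only [tensorRep, AlgHom.comp_apply, hc, TensorProduct.map_tmul, LinearMap.mul'_apply]
    cases x
    · simp [comulGen, Module.endTensorEndAlgHom_apply, lamMap_rep_gen ht, ad_e_mul]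
    · simp [comulGen, Module.endTensorEndAlgHom_apply, lamMap_rep_gen ht, ad_f_mul]
    · simp [comulGen, Module.endTensorEndAlgHom_apply, lamMap_rep_gen ht, ad_k_mul]
    · simp [comulGen, Module.endTensorEndAlgHom_apply, lamMap_rep_gen ht, ad_kinv_mul]

theorem mul_lamMap_coupledVec {j i : ℕ} (c : Weight j → Weight i → ℂ) :
    LinearMap.mul' ℂ (U t) (TensorProduct.map (lamMap t j) (lamMap t i) (coupledVec c)) =
      centralElt t c := by
  simp [coupledVec, centralElt, lamMap_vec]

/-- An intertwiner maps invariant vectors to invariant vectors; the complement `W` plays no part. -/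
theorem centralElt_mem_invariants (ht : t ^ 2 ≠ 1) {j i : ℕ} {c : Weight j → Weight i → ℂ}
    (hc : coupledVec c ∈ invariants (tensorRep (rep t j) (rep t i)).toLinearMap) :
    centralElt t c ∈ invariants (ad : U t →ₗ[ℂ] Module.End ℂ (U t)) := by
  refine mem_invariants_ad fun x => ?_
  rw [← mul_lamMap_coupledVec, ← mul_lamMap_tensorRep ht]
  have := hc (gen t x)
  rw [AlgHom.toLinearMap_apply, counit_gen] at this
  rw [this, map_smul, map_smul]

end Representation

/-! ### Invariant vectors of `V j ⊗ V i` and the trivial Clebsch–Gordan coefficients. -/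

section Invariants

variable {t : ℝ}

/-- The coordinates on `V l`, extended by zero to all integers. -/
noncomputable def coordZ (l : ℕ) (p : ℤ) : V l →ₗ[ℂ] ℂ :=
  if h : p ∈ Finset.Icc (-(l : ℤ)) l then LinearMap.proj ⟨p, h⟩ else 0

theorem coordZ_coe {l : ℕ} (m : Weight l) (v : V l) : coordZ l m v = v m := by
  simp only [coordZ, m.2, dite_true, LinearMap.proj_apply]

theorem coordZ_vecZ (l : ℕ) (p q : ℤ) :
    coordZ l p (vecZ l q) = if p = q ∧ p ∈ Finset.Icc (-(l : ℤ)) l then 1 else 0 := by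
  unfold coordZ
  split_ifs with h h1 h1
  · simp [vecZ_apply, h1.1]
  · simp only [LinearMap.proj_apply, vecZ_apply]
    exact if_neg fun h2 => h1 ⟨h2, h⟩
  · exact absurd h1.2 h
  · rfl

/-- The coordinates on `V j ⊗ V i`, extended by zero to all integers. -/
noncomputable def coord₂ (j i : ℕ) (p q : ℤ) : V j ⊗[ℂ] V i →ₗ[ℂ] ℂ :=
  LinearMap.mul' ℂ ℂ ∘ₗ TensorProduct.map (coordZ j p) (coordZ i q)

theorem coord₂_tmul {j i : ℕ} (p q : ℤ) (v : V j) (w : V i) :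
    coord₂ j i p q (v ⊗ₜ w) = coordZ j p v * coordZ i q w := by simp [coord₂]

theorem coord₂_of_notMem_left {j i : ℕ} {p : ℤ} (q : ℤ) (h : p ∉ Finset.Icc (-(j : ℤ)) j)
    (w : V j ⊗[ℂ] V i) : coord₂ j i p q w = 0 := by
  have : coordZ j p = 0 := by simp only [coordZ, h, dite_false]
  simp [coord₂, this]

theorem coord₂_of_notMem_right {j i : ℕ} (p : ℤ) {q : ℤ} (h : q ∉ Finset.Icc (-(i : ℤ)) i)
    (w : V j ⊗[ℂ] V i) : coord₂ j i p q w = 0 := by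
  have : coordZ i q = 0 := by simp only [coordZ, h, dite_false]
  simp [coord₂, this]

theorem sum_smul_vec {l : ℕ} (v : V l) : ∑ m, v m • (vec m : V l) = v := by
  ext p
  simp [Pi.single_apply]

theorem coupledVec_coord₂ {j i : ℕ} (w : V j ⊗[ℂ] V i) :
    coupledVec (fun m n => coord₂ j i m n w) = w := by
  unfold coupledVec
  induction w with
  | zero => simp
  | add v w hv hw =>
    simp only [map_add, add_smul, Finset.sum_add_distrib]
    rw [hv, hw]
  | tmul v w =>
    conv_rhs => rw [← sum_smul_vec v, ← sum_smul_vec w]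
    simp only [TensorProduct.sum_tmul, TensorProduct.tmul_sum, coord₂_tmul, coordZ_coe,
      TensorProduct.smul_tmul_smul]
    exact Finset.sum_comm

theorem coord₂_coupledVec {j i : ℕ} (c : Weight j → Weight i → ℂ) (m : Weight j) (n : Weight i) :
    coord₂ j i m n (coupledVec c) = c m n := by
  simp [coupledVec, coord₂_tmul, coordZ_coe, Pi.single_apply]

theorem coupledVec_smul {j i : ℕ} (s : ℂ) (c : Weight j → Weight i → ℂ) :
    coupledVec (s • c) = s • coupledVec c := by
  simp [coupledVec, Finset.smul_sum, smul_smul]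

theorem coupledVec_injective {j i : ℕ} :
    Function.Injective (coupledVec : (Weight j → Weight i → ℂ) → _) := by
  intro c d h
  ext m n
  rw [← coord₂_coupledVec c, h, coord₂_coupledVec]

/-- The bilinear pairing of a tensor with the coefficients `c`. -/
noncomputable def pairing {j i : ℕ} (c : Weight j → Weight i → ℂ) : V j ⊗[ℂ] V i →ₗ[ℂ] ℂ :=
  ∑ m : Weight j, ∑ n : Weight i, c m n • coord₂ j i m n

theorem pairing_vec {j i : ℕ} (c : Weight j → Weight i → ℂ) (m : Weight j) (n : Weight i) :
    pairing c (vec m ⊗ₜ[ℂ] vec n) = c m n := by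
  simp [pairing, coord₂_tmul, coordZ_coe, Pi.single_apply]

/-- Lets invariance of the functional `pairing c` be read off from coordinate identities for the
vector `coupledVec c`. -/
theorem pairing_vecZ {j i : ℕ} (c : Weight j → Weight i → ℂ) (p q : ℤ) :
    pairing c (vecZ j p ⊗ₜ[ℂ] vecZ i q) = coord₂ j i p q (coupledVec c) := by
  by_cases hp : p ∈ Finset.Icc (-(j : ℤ)) j
  · by_cases hq : q ∈ Finset.Icc (-(i : ℤ)) i
    · lift p to Weight j using hp
      lift q to Weight i using hq
      rw [vecZ_coe, vecZ_coe, pairing_vec, coord₂_coupledVec]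
    · rw [vecZ_of_notMem hq, TensorProduct.tmul_zero, map_zero, coord₂_of_notMem_right _ hq]
  · rw [vecZ_of_notMem hp, TensorProduct.zero_tmul, map_zero, coord₂_of_notMem_left _ hp]

theorem pairing_coupledVec {j i : ℕ} (c : Weight j → Weight i → ℂ) :
    pairing c (coupledVec c) = ∑ m, ∑ n, c m n * c m n := by
  simp only [pairing, LinearMap.sum_apply, LinearMap.smul_apply, coord₂_coupledVec, smul_eq_mul]

variable [NeZero t]

theorem coordZ_rep_e (l : ℕ) (p : ℤ) (v : V l) :
    coordZ l p (rep t l (e t) v) = step t l (p - 1) * coordZ l (p - 1) v := by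
  suffices h : coordZ l p ∘ₗ rep t l (e t) = step t l (p - 1) • coordZ l (p - 1) from
    LinearMap.congr_fun h v
  refine V_hom_ext fun q => ?_
  rw [LinearMap.comp_apply, rep_e_vecZ, map_smul, coordZ_vecZ, LinearMap.smul_apply, coordZ_vecZ]
  by_cases hpq : p = q + 1
  · subst hpq
    simp only [add_sub_cancel_right, true_and, Finset.mem_Icc]
    -- At `q = l` and `q = -l - 1` exactly one of the two range conditions holds, but there the
    -- coefficient vanishes.
    by_cases h1 : q = l
    · rw [h1, step_self, zero_smul, zero_smul]
    · by_cases h2 : q = -l - 1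
      · rw [h2, step_neg_self_sub_one, zero_smul, zero_smul]
      · congr 2
        exact propext ⟨fun h => ⟨by omega, by omega⟩, fun h => ⟨by omega, by omega⟩⟩
  · rw [if_neg fun h => hpq h.1, if_neg fun h => hpq (by omega), smul_zero, smul_zero]

theorem coordZ_rep_f (l : ℕ) (p : ℤ) (v : V l) :
    coordZ l p (rep t l (f t) v) = step t l p * coordZ l (p + 1) v := by
  suffices h : coordZ l p ∘ₗ rep t l (f t) = step t l p • coordZ l (p + 1) from
    LinearMap.congr_fun h v
  refine V_hom_ext fun q => ?_
  rw [LinearMap.comp_apply, rep_f_vecZ, map_smul, coordZ_vecZ, LinearMap.smul_apply, coordZ_vecZ]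
  by_cases hpq : q = p + 1
  · subst hpq
    simp only [add_sub_cancel_right, true_and, Finset.mem_Icc]
    by_cases h1 : p = l
    · rw [h1, step_self, zero_smul, zero_smul]
    · by_cases h2 : p = -l - 1
      · rw [h2, step_neg_self_sub_one, zero_smul, zero_smul]
      · congr 2
        exact propext ⟨fun h => ⟨by omega, by omega⟩, fun h => ⟨by omega, by omega⟩⟩
  · rw [if_neg fun h => hpq (by omega), if_neg fun h => hpq (by omega), smul_zero, smul_zero]

theorem coordZ_rep_k (l : ℕ) (p : ℤ) (v : V l) :
    coordZ l p (rep t l (k t) v) = (t : ℂ) ^ (2 * p) * coordZ l p v := by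
  suffices h : coordZ l p ∘ₗ rep t l (k t) = (t : ℂ) ^ (2 * p) • coordZ l p from
    LinearMap.congr_fun h v
  refine V_hom_ext fun q => ?_
  rw [LinearMap.comp_apply, rep_k_vecZ, map_smul, coordZ_vecZ, LinearMap.smul_apply, coordZ_vecZ]
  split_ifs with h
  · rw [h.1]
  · simp

theorem coordZ_rep_kinv (l : ℕ) (p : ℤ) (v : V l) :
    coordZ l p (rep t l (kinv t) v) = (t : ℂ) ^ (-(2 * p)) * coordZ l p v := by
  suffices h : coordZ l p ∘ₗ rep t l (kinv t) = (t : ℂ) ^ (-(2 * p)) • coordZ l p from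
    LinearMap.congr_fun h v
  refine V_hom_ext fun q => ?_
  rw [LinearMap.comp_apply, rep_kinv_vecZ, map_smul, coordZ_vecZ, LinearMap.smul_apply,
    coordZ_vecZ]
  split_ifs with h
  · rw [h.1]
  · simp

variable (t) in
/-- The representation of `U t` on `V j ⊗ V i`. -/
noncomputable abbrev rep₂ (j i : ℕ) : U t →ₐ[ℂ] Module.End ℂ (V j ⊗[ℂ] V i) :=
  tensorRep (rep t j) (rep t i)

theorem rep₂_gen (j i : ℕ) (x : Gen) : rep₂ t j i (gen t x) =
    Module.endTensorEndAlgHom (R := ℂ) (S := ℂ) (A := ℂ) (M := V j) (N := V i)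
      (Algebra.TensorProduct.map (rep t j) (rep t i) (comulGen t x)) := by
  have hc : Bialgebra.comulAlgHom ℂ (U t) (gen t x) = comulGen t x := comul_gen x
  simp [rep₂, tensorRep, hc]

theorem rep₂_e_tmul {j i : ℕ} (v : V j) (w : V i) : rep₂ t j i (e t) (v ⊗ₜ w) =
    rep t j (e t) v ⊗ₜ rep t i (kinv t) w + rep t j (k t) v ⊗ₜ rep t i (e t) w := by
  simp [rep₂_gen, comulGen, Module.endTensorEndAlgHom_apply]

theorem rep₂_f_tmul {j i : ℕ} (v : V j) (w : V i) : rep₂ t j i (f t) (v ⊗ₜ w) =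
    rep t j (f t) v ⊗ₜ rep t i (kinv t) w + rep t j (k t) v ⊗ₜ rep t i (f t) w := by
  simp [rep₂_gen, comulGen, Module.endTensorEndAlgHom_apply]

theorem rep₂_k_tmul {j i : ℕ} (v : V j) (w : V i) : rep₂ t j i (k t) (v ⊗ₜ w) =
    rep t j (k t) v ⊗ₜ rep t i (k t) w := by
  simp [rep₂_gen, comulGen, Module.endTensorEndAlgHom_apply]

theorem rep₂_kinv_tmul {j i : ℕ} (v : V j) (w : V i) : rep₂ t j i (kinv t) (v ⊗ₜ w) =
    rep t j (kinv t) v ⊗ₜ rep t i (kinv t) w := by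
  simp [rep₂_gen, comulGen, Module.endTensorEndAlgHom_apply]

theorem coord₂_rep₂_e {j i : ℕ} (p q : ℤ) (w : V j ⊗[ℂ] V i) :
    coord₂ j i p q (rep₂ t j i (e t) w) =
      step t j (p - 1) * (t : ℂ) ^ (-(2 * q)) * coord₂ j i (p - 1) q w +
      (t : ℂ) ^ (2 * p) * step t i (q - 1) * coord₂ j i p (q - 1) w := by
  induction w with
  | zero => simp
  | add v w hv hw => simp only [map_add, hv, hw]; ring
  | tmul v w =>
    rw [rep₂_e_tmul, map_add]
    simp only [coord₂_tmul, coordZ_rep_e, coordZ_rep_k, coordZ_rep_kinv]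
    ring

theorem coord₂_rep₂_f {j i : ℕ} (p q : ℤ) (w : V j ⊗[ℂ] V i) :
    coord₂ j i p q (rep₂ t j i (f t) w) =
      step t j p * (t : ℂ) ^ (-(2 * q)) * coord₂ j i (p + 1) q w +
      (t : ℂ) ^ (2 * p) * step t i q * coord₂ j i p (q + 1) w := by
  induction w with
  | zero => simp
  | add v w hv hw => simp only [map_add, hv, hw]; ring
  | tmul v w =>
    rw [rep₂_f_tmul, map_add]
    simp only [coord₂_tmul, coordZ_rep_f, coordZ_rep_k, coordZ_rep_kinv]
    ring

theorem coord₂_rep₂_k {j i : ℕ} (p q : ℤ) (w : V j ⊗[ℂ] V i) :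
    coord₂ j i p q (rep₂ t j i (k t) w) = (t : ℂ) ^ (2 * (p + q)) * coord₂ j i p q w := by
  have ht : (t : ℂ) ≠ 0 := ofReal_ne_zero'
  induction w with
  | zero => simp
  | add v w hv hw => simp only [map_add, hv, hw]; ring
  | tmul v w =>
    rw [rep₂_k_tmul]
    simp only [coord₂_tmul, coordZ_rep_k, mul_add, zpow_add₀ ht]
    ring

theorem coord₂_rep₂_kinv {j i : ℕ} (p q : ℤ) (w : V j ⊗[ℂ] V i) :
    coord₂ j i p q (rep₂ t j i (kinv t) w) = (t : ℂ) ^ (-(2 * (p + q))) * coord₂ j i p q w := by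
  have ht : (t : ℂ) ≠ 0 := ofReal_ne_zero'
  induction w with
  | zero => simp
  | add v w hv hw => simp only [map_add, hv, hw]; ring
  | tmul v w =>
    rw [rep₂_kinv_tmul]
    simp only [coord₂_tmul, coordZ_rep_kinv, mul_add, neg_add, zpow_add₀ ht]
    ring

/-! ### Invariant vectors of `V j ⊗ V i` -/

theorem eq_zero_of_coord₂ {j i : ℕ} {w : V j ⊗[ℂ] V i}
    (h : ∀ p q : ℤ, coord₂ j i p q w = 0) : w = 0 := by
  rw [← coupledVec_coord₂ w]
  simp [coupledVec, h]

theorem coord₂_eq_zero_of_invariant (ht : t ^ 2 ≠ 1) {j i : ℕ} {w : V j ⊗[ℂ] V i}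
    (hw : w ∈ invariants (rep₂ t j i).toLinearMap) {p q : ℤ} (h : q ≠ -p) :
    coord₂ j i p q w = 0 := by
  have h1 := congrArg (coord₂ j i p q) (hw (k t))
  rw [AlgHom.toLinearMap_apply, coord₂_rep₂_k, counit_gen, counitGen, one_smul] at h1
  by_contra h2
  have h3 : (t : ℂ) ^ (2 * (p + q)) = 1 := mul_right_cancel₀ h2 (h1.trans (one_mul _).symm)
  have := zpow_two_mul_eq_one ht (n := p + q) (by exact_mod_cast h3)
  omega

/-- The coordinate of `e w = 0` at `(p + 1, -p)` receives contributions only from `(p, -p)` and `(p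
+ 1, -p - 1)`. -/
theorem step_mul_coord₂_of_invariant {j i : ℕ} {w : V j ⊗[ℂ] V i}
    (hw : w ∈ invariants (rep₂ t j i).toLinearMap) (p : ℤ) :
    step t i p * coord₂ j i (p + 1) (-(p + 1)) w =
      -(((t : ℂ) ^ 2)⁻¹ * (step t j p * coord₂ j i p (-p) w)) := by
  have ht : (t : ℂ) ≠ 0 := ofReal_ne_zero'
  have h1 := congrArg (coord₂ j i (p + 1) (-p)) (hw (e t))
  rw [AlgHom.toLinearMap_apply, coord₂_rep₂_e, counit_gen, counitGen, zero_smul, map_zero,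
    step_neg, add_sub_cancel_right, mul_add, zpow_add₀ ht, mul_neg, neg_neg] at h1
  rw [neg_add, ← sub_eq_add_neg]
  have h2 : (t : ℂ) ^ (2 * p) ≠ 0 := zpow_ne_zero _ ht
  have h3 : (t : ℂ) ^ (2 * (1 : ℤ)) = (t : ℂ) ^ 2 := by norm_cast
  rw [h3] at h1
  field_simp
  refine mul_left_cancel₀ h2 ?_
  linear_combination h1

/-- Since `j ≤ i`, the coefficient `step t i p` is non-zero for `-j ≤ p < j`, so the recursion
climbs from `p = -j` through all weights of `V j`. -/
theorem invariant_eq_zero_of_lowest (ht : t ^ 2 ≠ 1) {j i : ℕ} (hji : j ≤ i) {w : V j ⊗[ℂ] V i}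
    (hw : w ∈ invariants (rep₂ t j i).toLinearMap) (h0 : coord₂ j i (-j) (- -j) w = 0) :
    w = 0 := by
  refine eq_zero_of_coord₂ fun p q => ?_
  by_cases hq : q = -p
  · subst hq
    by_cases hp : p ∈ Finset.Icc (-(j : ℤ)) j
    · rw [Finset.mem_Icc] at hp
      obtain ⟨hp1, hp2⟩ := hp
      induction p, hp1 using Int.leInduction with
      | base => exact h0
      | succ p hp ih =>
        have := step_mul_coord₂_of_invariant hw p
        rw [ih (by omega), mul_zero, mul_zero, neg_zero] at this
        exact (mul_eq_zero.1 this).resolve_left (step_ne_zero ht (by omega) (by omega))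
    · exact coord₂_of_notMem_left _ hp _
  · exact coord₂_eq_zero_of_invariant ht hw hq

theorem invariant_eq_zero_of_ne (ht : t ^ 2 ≠ 1) {j i : ℕ} (hji : j ≠ i) {w : V j ⊗[ℂ] V i}
    (hw : w ∈ invariants (rep₂ t j i).toLinearMap) : w = 0 := by
  rcases hji.lt_or_gt with h | h
  · refine invariant_eq_zero_of_lowest ht h.le hw ?_
    -- Just below the range of `V j` the right side of the recursion vanishes, while `step t i (-j -
    -- 1) ≠ 0` because `j < i`.
    have := step_mul_coord₂_of_invariant hw (-j - 1)
    rw [step_neg_self_sub_one, zero_mul, mul_zero, neg_zero, sub_add_cancel] at this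
    exact (mul_eq_zero.1 this).resolve_left (step_ne_zero ht (by omega) (by omega))
  · refine eq_zero_of_coord₂ fun p q => ?_
    by_cases hq : q = -p
    · subst hq
      by_cases hp : -p ∈ Finset.Icc (-(i : ℤ)) i
      · rw [Finset.mem_Icc] at hp
        obtain ⟨hp2, hp1⟩ := hp
        have hp2 : p ≤ i := by omega
        -- For `i < j` the recursion is run downwards: `step t j p ≠ 0` on all weights of `V i`, and
        -- it starts at `p = i`, where `step t i i = 0`.
        have descend (p : ℤ) (h1 : -(i : ℤ) ≤ p) (h2 : p ≤ i)
            (h3 : step t i p * coord₂ j i (p + 1) (-(p + 1)) w = 0) :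
            coord₂ j i p (-p) w = 0 := by
          have := step_mul_coord₂_of_invariant hw p
          rw [h3, eq_comm, neg_eq_zero] at this
          have h4 := (mul_eq_zero.1 this).resolve_left (inv_ne_zero (sq_ne_zero' t))
          exact (mul_eq_zero.1 h4).resolve_left (step_ne_zero ht (by omega) (by omega))
        induction p, hp2 using Int.leInductionDown with
        | base => exact descend i (by omega) le_rfl (by rw [step_self, zero_mul])
        | pred p hp ih =>
          refine descend (p - 1) (by omega) (by omega) ?_
          rw [sub_add_cancel, ih (by omega) (by omega), mul_zero]
      · exact coord₂_of_notMem_right _ hp _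
    · exact coord₂_eq_zero_of_invariant ht hw hq

theorem mem_invariants_rep₂ {j i : ℕ} {w : V j ⊗[ℂ] V i}
    (h : ∀ x, rep₂ t j i (gen t x) w = counitGen x • w) :
    w ∈ invariants (rep₂ t j i).toLinearMap := by
  intro a
  rw [AlgHom.toLinearMap_apply]
  induction a using induction with
  | hgen x => rw [h, counit_gen]
  | hc c => rw [AlgHom.commutes, Bialgebra.counit_algebraMap]; simp
  | hadd a b ha hb => rw [map_add, map_add, LinearMap.add_apply, ha, hb, add_smul]
  | hmul a b ha hb =>
    rw [map_mul, Bialgebra.counit_mul, Module.End.mul_apply, hb, map_smul, ha, smul_smul, mul_comm]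

theorem V_tensor_hom_ext {j i : ℕ} {φ ψ : V j ⊗[ℂ] V i →ₗ[ℂ] ℂ}
    (h : ∀ p q : ℤ, φ (vecZ j p ⊗ₜ vecZ i q) = ψ (vecZ j p ⊗ₜ vecZ i q)) : φ = ψ := by
  refine TensorProduct.ext (V_hom_ext fun p => V_hom_ext fun q => ?_)
  simpa using h p q

/-! ### The closed formula for the coefficients -/

variable (t) in
/-- The invariant vector given by the closed formula. -/
noncomputable abbrev cgVec (j i : ℕ) : V j ⊗[ℂ] V i := coupledVec (clebschGordan t j i)

omit [NeZero t] in
theorem clebschGordan_of_ne {j i : ℕ} (h : j ≠ i) : clebschGordan t j i = 0 := by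
  ext m n
  exact if_neg fun h1 => h h1.1

omit [NeZero t] in
theorem coord₂_cgVec (l : ℕ) (p q : ℤ) : coord₂ l l p q (cgVec t l l) =
    if p = -q ∧ p ∈ Finset.Icc (-(l : ℤ)) l then
      (((-1) ^ (l - p) * t ^ (-(2 * p)) / Real.sqrt (qInt t (2 * l + 1)) : ℝ) : ℂ) else 0 := by
  by_cases hp : p ∈ Finset.Icc (-(l : ℤ)) l
  · by_cases hq : q ∈ Finset.Icc (-(l : ℤ)) l
    · lift p to Weight l using hp with m
      lift q to Weight l using hq
      rw [coord₂_coupledVec]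
      simp only [clebschGordan, true_and, m.2, and_true]
    · rw [coord₂_of_notMem_right _ hq, if_neg]
      rintro ⟨rfl, -⟩
      rw [Finset.mem_Icc] at hp hq
      omega
  · rw [coord₂_of_notMem_left _ hp, if_neg fun h => hp h.2]

/-- The closed formula changes by `-t⁻²` when `p` increases by `1`; the factor `step t l p` absorbs
the edges. Invariance under both `e` and `f` reduces to this identity. -/
theorem step_mul_coord₂_cgVec (l : ℕ) (p : ℤ) :
    step t l p * ((t : ℂ) ^ 2 * coord₂ l l (p + 1) (-(p + 1)) (cgVec t l l) +
      coord₂ l l p (-p) (cgVec t l l)) = 0 := by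
  have ht : t ≠ 0 := NeZero.ne t
  by_cases h1 : p = l
  · rw [h1, step_self, zero_mul]
  by_cases h2 : p = -l - 1
  · rw [h2, step_neg_self_sub_one, zero_mul]
  simp only [coord₂_cgVec, neg_neg, true_and, Finset.mem_Icc]
  by_cases h3 : -(l : ℤ) ≤ p ∧ p ≤ l
  · rw [if_pos h3, if_pos ⟨by omega, by omega⟩, ← sub_sub, zpow_sub_one₀ (by norm_num),
      mul_add (2 : ℤ), neg_add, zpow_add₀ ht, show -(2 * (1 : ℤ)) = -(2 : ℕ) by norm_num, zpow_neg t ((2 : ℕ) : ℤ),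
      zpow_natCast]
    norm_cast
    rw [mul_eq_zero]
    right
    field_simp
    norm_num
  · rw [if_neg h3, if_neg fun h => h3 ⟨by omega, by omega⟩]
    simp

theorem cgVec_raise (l : ℕ) (p q : ℤ) :
    step t l (p - 1) * (t : ℂ) ^ (-(2 * q)) * coord₂ l l (p - 1) q (cgVec t l l) +
      (t : ℂ) ^ (2 * p) * step t l (q - 1) * coord₂ l l p (q - 1) (cgVec t l l) = 0 := by
  have ht : (t : ℂ) ≠ 0 := ofReal_ne_zero'
  by_cases h : q = -(p - 1)
  · have := step_mul_coord₂_cgVec (t := t) l (p - 1)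
    rw [sub_add_cancel] at this
    subst h
    rw [show -(p - 1) - 1 = -p by ring, show step t l (-p) = step t l (p - 1) by
      rw [← step_neg]; congr 1; ring, show 2 * p = 2 * (p - 1) + (2 : ℕ) by push_cast; ring,
      zpow_add₀ ht, zpow_natCast, mul_neg, neg_neg]
    linear_combination (t : ℂ) ^ (2 * (p - 1)) * this
  · simp only [coord₂_cgVec]
    rw [if_neg fun h1 => h (by omega), if_neg fun h1 => h (by omega)]
    simp

theorem cgVec_lower (l : ℕ) (p q : ℤ) :
    step t l p * (t : ℂ) ^ (-(2 * q)) * coord₂ l l (p + 1) q (cgVec t l l) +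
      (t : ℂ) ^ (2 * p) * step t l q * coord₂ l l p (q + 1) (cgVec t l l) = 0 := by
  have ht : (t : ℂ) ≠ 0 := ofReal_ne_zero'
  by_cases h : q = -(p + 1)
  · have := step_mul_coord₂_cgVec (t := t) l p
    subst h
    rw [show -(p + 1) + 1 = -p by ring, show step t l (-(p + 1)) = step t l p by
      rw [← step_neg]; congr 1; ring, mul_neg, neg_neg,
      show 2 * (p + 1) = 2 * p + (2 : ℕ) by push_cast; ring, zpow_add₀ ht, zpow_natCast]
    linear_combination (t : ℂ) ^ (2 * p) * this
  · simp only [coord₂_cgVec]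
    rw [if_neg fun h1 => h (by omega), if_neg fun h1 => h (by omega)]
    simp

omit [NeZero t] in
theorem coord₂_cgVec_of_ne (l : ℕ) {p q : ℤ} (h : p + q ≠ 0) :
    coord₂ l l p q (cgVec t l l) = 0 := by
  rw [coord₂_cgVec, if_neg fun h1 => h (by omega)]

theorem cgVec_mem_invariants (j i : ℕ) :
    cgVec t j i ∈ invariants (rep₂ t j i).toLinearMap := by
  by_cases hji : j = i
  · subst hji
    refine mem_invariants_rep₂ fun x => ?_
    rw [← sub_eq_zero]
    refine eq_zero_of_coord₂ fun p q => ?_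
    rw [map_sub, sub_eq_zero, map_smul]
    cases x
    · rw [coord₂_rep₂_e, cgVec_raise]; simp [counitGen]
    · rw [coord₂_rep₂_f, cgVec_lower]; simp [counitGen]
    · rw [coord₂_rep₂_k]
      by_cases h : p + q = 0
      · simp [h, counitGen]
      · simp [coord₂_cgVec_of_ne j h]
    · rw [coord₂_rep₂_kinv]
      by_cases h : p + q = 0
      · simp [h, counitGen]
      · simp [coord₂_cgVec_of_ne j h]
  · have : cgVec t j i = 0 := by simp [cgVec, clebschGordan_of_ne hji, coupledVec]
    rw [this]
    exact zero_mem _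

/-- Transposition exchanges raising and lowering: invariance of the functional under `e` is the
coordinate identity for `f` on the vector, and conversely. -/
theorem pairing_rep₂_gen (l : ℕ) (x : Gen) (w : V l ⊗[ℂ] V l) :
    pairing (clebschGordan t l l) (rep₂ t l l (gen t x) w) =
      counitGen x * pairing (clebschGordan t l l) w := by
  suffices h : pairing (clebschGordan t l l) ∘ₗ rep₂ t l l (gen t x) =
      counitGen x • pairing (clebschGordan t l l) from LinearMap.congr_fun h w
  have ht : (t : ℂ) ≠ 0 := ofReal_ne_zero'
  refine V_tensor_hom_ext fun p q => ?_
  rw [LinearMap.comp_apply, LinearMap.smul_apply, pairing_vecZ]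
  cases x
  · rw [rep₂_e_tmul, rep_e_vecZ, rep_e_vecZ, rep_k_vecZ, rep_kinv_vecZ]
    simp only [TensorProduct.smul_tmul_smul, map_add, map_smul, pairing_vecZ, smul_eq_mul,
      counitGen, zero_mul]
    exact cgVec_lower l p q
  · rw [rep₂_f_tmul, rep_f_vecZ, rep_f_vecZ, rep_k_vecZ, rep_kinv_vecZ]
    simp only [TensorProduct.smul_tmul_smul, map_add, map_smul, pairing_vecZ, smul_eq_mul,
      counitGen, zero_mul]
    exact cgVec_raise l p q
  · rw [rep₂_k_tmul, rep_k_vecZ, rep_k_vecZ, TensorProduct.smul_tmul_smul, map_smul, pairing_vecZ,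
      ← zpow_add₀ ht, ← mul_add]
    by_cases h : p + q = 0
    · simp [h, counitGen]
    · simp [coord₂_cgVec_of_ne l h]
  · rw [rep₂_kinv_tmul, rep_kinv_vecZ, rep_kinv_vecZ, TensorProduct.smul_tmul_smul, map_smul,
      pairing_vecZ, ← zpow_add₀ ht, ← neg_add, ← mul_add]
    by_cases h : p + q = 0
    · simp [h, counitGen]
    · simp [coord₂_cgVec_of_ne l h]

theorem rep₂_mem_ker_pairing (j i : ℕ) (a : U t) (w : V j ⊗[ℂ] V i)
    (hw : w ∈ LinearMap.ker (pairing (clebschGordan t j i))) :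
    rep₂ t j i a w ∈ LinearMap.ker (pairing (clebschGordan t j i)) := by
  by_cases hji : j = i
  · subst hji
    induction a using induction generalizing w with
    | hgen x =>
      rw [LinearMap.mem_ker] at hw ⊢
      rw [pairing_rep₂_gen, hw, mul_zero]
    | hc c =>
      rw [AlgHom.commutes, Module.algebraMap_end_apply]
      exact Submodule.smul_mem _ _ hw
    | hadd a b ha hb =>
      rw [map_add, LinearMap.add_apply]
      exact add_mem (ha w hw) (hb w hw)
    | hmul a b ha hb =>
      rw [map_mul, Module.End.mul_apply]
      exact ha _ (hb w hw)
  · simp [clebschGordan_of_ne hji, pairing]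

/-- Multiplied by `t² - t⁻²` the sum telescopes; the induction adds the two terms `p = ±(l + 1)`. -/
theorem sum_zpow_eq_qInt (ht : t ^ 2 ≠ 1) (l : ℕ) :
    ∑ p ∈ Finset.Icc (-(l : ℤ)) l, t ^ (-(4 * p)) = qInt t (2 * l + 1) := by
  have h0 : t ≠ 0 := NeZero.ne t
  have hD := sq_sub_inv_ne_zero ht
  rw [qInt, eq_div_iff hD]
  induction l with
  | zero => simp
  | succ l ih =>
    have h1 : Finset.Icc (-((l + 1 : ℕ) : ℤ)) (l + 1 : ℕ) =
        insert (-((l : ℤ) + 1)) (insert ((l : ℤ) + 1) (Finset.Icc (-(l : ℤ)) l)) := by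
      ext p
      simp only [Finset.mem_Icc, Finset.mem_insert]
      omega
    rw [h1, Finset.sum_insert, Finset.sum_insert, add_mul, add_mul, ih]
    · have h2 : t ^ 2 = t ^ (2 : ℤ) := by norm_cast
      have h3 : (t ^ 2)⁻¹ = t ^ (-2 : ℤ) := by rw [zpow_neg]; norm_cast
      rw [h3, h2]
      simp only [mul_sub, ← zpow_add₀ h0]
      push_cast
      ring_nf
    · simp
    · simp only [Finset.mem_insert, Finset.mem_Icc]
      omega

omit [NeZero t] in
theorem clebschGordan_apply (l : ℕ) (m n : Weight l) :
    clebschGordan t l l m n = if (m : ℤ) = -n then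
      (((-1) ^ (l - m : ℤ) * t ^ (-(2 * (m : ℤ))) / Real.sqrt (qInt t (2 * l + 1)) : ℝ) : ℂ)
      else 0 := by
  simp [clebschGordan]

/-- The opposite weight. -/
def Weight.neg {l : ℕ} (m : Weight l) : Weight l :=
  ⟨-m, Finset.mem_Icc.2 (by have := Finset.mem_Icc.1 m.2; omega)⟩

theorem Weight.eq_neg_iff {l : ℕ} (m n : Weight l) : (m : ℤ) = -n ↔ n = m.neg := by
  rw [Subtype.ext_iff, Weight.neg]
  simp only
  omega

/-- The normalization by `[2l+1]^{1/2}` makes `w ↦ pairing w • cgVec` a projection onto the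
invariant line. The pairing is bilinear, so the signs square away. -/
theorem pairing_cgVec (ht : t ^ 2 ≠ 1) (l : ℕ) :
    pairing (clebschGordan t l l) (cgVec t l l) = 1 := by
  have hq : 0 < qInt t (2 * l + 1) := qInt_pos ht (by positivity)
  have h0 : t ≠ 0 := NeZero.ne t
  rw [pairing_coupledVec]
  have h1 (m : Weight l) : ∑ n, clebschGordan t l l m n * clebschGordan t l l m n =
      ((t ^ (-(4 * (m : ℤ))) / qInt t (2 * l + 1) : ℝ) : ℂ) := by
    simp only [clebschGordan_apply, Weight.eq_neg_iff, mul_ite, mul_zero]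
    rw [Finset.sum_ite_eq' Finset.univ m.neg]
    simp only [Finset.mem_univ, if_true]
    rw [← Complex.ofReal_mul, div_mul_div_comm, Real.mul_self_sqrt hq.le, mul_mul_mul_comm,
      ← mul_zpow, ← zpow_add₀ h0]
    rw [show (-1 : ℝ) * -1 = 1 by norm_num, one_zpow, one_mul]
    congr 3
    ring
  simp only [h1]
  rw [← Complex.ofReal_sum, ← Finset.sum_div,
    Finset.sum_coe_sort (Finset.Icc (-(l : ℤ)) l) fun p => t ^ (-(4 * p)), sum_zpow_eq_qInt ht,
    div_self hq.ne', Complex.ofReal_one]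

/-- Subtracting the multiple that matches the lowest coordinate leaves an invariant vector with
lowest coordinate `0`. -/
theorem exists_eq_smul_cgVec (ht : t ^ 2 ≠ 1) {l : ℕ} {w : V l ⊗[ℂ] V l}
    (hw : w ∈ invariants (rep₂ t l l).toLinearMap) : ∃ s : ℂ, w = s • cgVec t l l := by
  have h0 : coord₂ l l (-l) (- -l) (cgVec t l l) ≠ 0 := by
    intro h
    have h1 := invariant_eq_zero_of_lowest ht le_rfl (cgVec_mem_invariants l l) h
    have h2 := pairing_cgVec ht l
    rw [h1, map_zero] at h2
    exact zero_ne_one h2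
  refine ⟨coord₂ l l (-l) (- -l) w / coord₂ l l (-l) (- -l) (cgVec t l l), sub_eq_zero.1 ?_⟩
  refine invariant_eq_zero_of_lowest ht le_rfl
    (sub_mem hw (Submodule.smul_mem _ _ (cgVec_mem_invariants l l))) ?_
  rw [map_sub, map_smul, smul_eq_mul, div_mul_cancel₀ _ h0, sub_self]

theorem isTrivialClebschGordan_clebschGordan (ht : t ^ 2 ≠ 1) (j i : ℕ) :
    IsTrivialClebschGordan t j i (clebschGordan t j i) := by
  refine ⟨cgVec_mem_invariants j i, LinearMap.ker (pairing (clebschGordan t j i)),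
    fun a w hw => rep₂_mem_ker_pairing j i a w hw, ?_⟩
  by_cases hji : j = i
  · subst hji
    have h1 := pairing_cgVec ht j
    refine ⟨⟨?_, ?_⟩, ?_, fun m n => ?_⟩
    · rw [Submodule.disjoint_def]
      intro w hw hw'
      obtain ⟨s, rfl⟩ := Submodule.mem_span_singleton.1 hw
      rw [LinearMap.mem_ker, map_smul, h1, smul_eq_mul, mul_one] at hw'
      rw [hw', zero_smul]
    · rw [codisjoint_iff, eq_top_iff]
      intro w _
      rw [Submodule.mem_sup]
      refine ⟨pairing (clebschGordan t j j) w • cgVec t j j,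
        Submodule.smul_mem _ _ (Submodule.mem_span_singleton_self _),
        w - pairing (clebschGordan t j j) w • cgVec t j j, ?_, by abel⟩
      rw [LinearMap.mem_ker, map_sub, map_smul, h1, smul_eq_mul, mul_one, sub_self]
    · rw [eq_bot_iff]
      rintro w ⟨hw, hw'⟩
      obtain ⟨s, rfl⟩ := exists_eq_smul_cgVec ht hw'
      rw [SetLike.mem_coe, LinearMap.mem_ker, map_smul, h1, smul_eq_mul, mul_one] at hw
      rw [hw, zero_smul]
      exact zero_mem _
    · rw [LinearMap.mem_ker, map_sub, map_smul, h1, pairing_vec, smul_eq_mul, mul_one, sub_self]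
  -- For `j ≠ i` the coefficients vanish and `W` is the whole space, which has no non-zero
  -- invariants.
  · have h0 : coupledVec (clebschGordan t j i) = 0 := by
      simp [clebschGordan_of_ne hji, coupledVec]
    have h1 : LinearMap.ker (pairing (clebschGordan t j i)) = ⊤ := by
      rw [LinearMap.ker_eq_top]
      simp [clebschGordan_of_ne hji, pairing]
    rw [h0, h1, Submodule.span_zero_singleton]
    refine ⟨isCompl_bot_top, ?_, fun _ _ => Submodule.mem_top⟩
    rw [top_inf_eq, eq_bot_iff]
    intro w hw
    rw [invariant_eq_zero_of_ne ht hji hw]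
    exact zero_mem _

theorem IsTrivialClebschGordan.eq_zero (ht : t ^ 2 ≠ 1) {j i : ℕ} (hji : j ≠ i)
    {c : Weight j → Weight i → ℂ} (hc : IsTrivialClebschGordan t j i c) : c = 0 := by
  refine coupledVec_injective ?_
  rw [invariant_eq_zero_of_ne ht hji hc.1]
  simp [coupledVec]

theorem IsTrivialClebschGordan.exists_eq_smul (ht : t ^ 2 ≠ 1) {l : ℕ}
    {c : Weight l → Weight l → ℂ} (hc : IsTrivialClebschGordan t l l c) :
    ∃ s : ℂ, s ≠ 0 ∧ c = s • clebschGordan t l l := by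
  obtain ⟨s, hs⟩ := exists_eq_smul_cgVec ht hc.1
  refine ⟨s, ?_, coupledVec_injective (by rw [hs, coupledVec_smul])⟩
  -- If `s = 0`, then `W` is everything and contains the non-zero invariant `cgVec`, against the
  -- condition on `W`.
  rintro rfl
  obtain ⟨-, W, -, hW, hinv, -⟩ := hc
  rw [hs, zero_smul, Submodule.span_zero_singleton] at hW
  have hW' : W = ⊤ := by simpa using hW.sup_eq_top
  rw [hW', top_inf_eq] at hinv
  have h1 := cgVec_mem_invariants (t := t) l l
  rw [hinv, Submodule.mem_bot] at h1
  have h2 := pairing_cgVec ht l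
  rw [h1, map_zero] at h2
  exact zero_ne_one h2

end Invariants

/-! ### Non-vanishing of `C` by positivity in the representation `π^l`. -/

section Nonvanishing

variable {t : ℝ} [NeZero t]

open scoped Matrix

omit [NeZero t] in
theorem repGen_e_conjTranspose (l : ℕ) : (repGen t l .e)ᴴ = repGen t l .f := by
  ext p m
  simp only [repGen, Matrix.conjTranspose_apply, Matrix.of_apply]
  by_cases h : (m : ℤ) = p + 1
  · rw [if_pos h, if_pos (by omega), Complex.star_def, Complex.conj_ofReal, mul_comm, h]
    congr 4 <;> ring
  · rw [if_neg h, if_neg (by omega), star_zero]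

omit [NeZero t] in
theorem repGen_f_conjTranspose (l : ℕ) : (repGen t l .f)ᴴ = repGen t l .e := by
  rw [← repGen_e_conjTranspose, Matrix.conjTranspose_conjTranspose]

omit [NeZero t] in
theorem repGen_k_conjTranspose (l : ℕ) : (repGen t l .k)ᴴ = repGen t l .k := by
  simp only [repGen, Matrix.diagonal_conjTranspose]
  congr 1
  ext m
  simp

omit [NeZero t] in
theorem repGen_kinv_conjTranspose (l : ℕ) : (repGen t l .kinv)ᴴ = repGen t l .kinv := by
  simp only [repGen, Matrix.diagonal_conjTranspose]
  congr 1
  ext m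
  simp

/-- The adjoint of `f z k - t² k z f` is `-t²` times `e z* k - t⁻² k z* e`, so taking adjoints turns
`ad_f` into `ad_e` up to a factor. -/
theorem matRep_ad_e (l : ℕ) {y z : U t} {s : ℂ} (h : matRep t l y = s • (matRep t l z)ᴴ) :
    matRep t l (ad (e t) y) = (-((t : ℂ) ^ 2)⁻¹ * s) • (matRep t l (ad (f t) z))ᴴ := by
  have ht := sq_ne_zero' t
  rw [ad_e_apply, ad_f_apply]
  simp only [map_sub, map_mul, map_smul, h, matRep_gen, Matrix.conjTranspose_sub,
    Matrix.conjTranspose_mul, Matrix.conjTranspose_smul, repGen_f_conjTranspose,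
    repGen_k_conjTranspose, star_pow, Complex.star_def, Complex.conj_ofReal, smul_sub,
    mul_smul_comm, smul_mul_assoc, smul_smul, mul_assoc]
  rw [show -((t : ℂ) ^ 2)⁻¹ * (s * (t : ℂ) ^ 2) = -s by
    rw [neg_mul, mul_left_comm, inv_mul_cancel₀ ht, mul_one]]
  rw [neg_smul, neg_mul, neg_smul]
  abel

theorem lamCoeff_zero_ne_zero (ht : t ^ 2 ≠ 1) (l : ℕ) : (lamCoeff t l 0 : ℂ) ≠ 0 := by
  rw [Complex.ofReal_ne_zero, lamCoeff, Real.sqrt_ne_zero']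
  have := qFact_pos ht (2 * l - 0)
  have := qFact_pos ht (2 * l)
  have := qFact_pos ht 0
  positivity

/-- At `n = 0`, `λ_{-l}` is a multiple of `k^{-l} f^l`, the adjoint of `e^l k^{-l}` in `π^l`.
Raising one side and lowering the other uses the same matrix coefficient and costs `-t⁻²` per step.
-/
theorem exists_matRep_lamZ_neg (ht : t ^ 2 ≠ 1) (l : ℕ) : ∃ s : ℂ, ∀ n ≤ 2 * l,
    matRep t l (lamZ t l (-(l - n))) =
      ((-((t : ℂ) ^ 2)⁻¹) ^ n * s) • (matRep t l (lamZ t l (l - n)))ᴴ := by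
  have hc := lamCoeff_zero_ne_zero ht l
  obtain ⟨s, hs⟩ := (ad_f_pow_highest (t := t) l).2
  -- The numerator is the coefficient of `k^{-l} f^l` in `λ_{-l}`; the denominator removes the
  -- normalization of `λ_l`.
  refine ⟨lamCoeff t l (2 * l) * s / lamCoeff t l 0, fun n => ?_⟩
  induction n with
  | zero =>
    intro _
    have h1 := lamZ_sub (t := t) (l := l) (le_refl (2 * l))
    rw [show (l : ℤ) - (2 * l : ℕ) = -(l - (0 : ℕ)) by push_cast; ring] at h1
    rw [h1, hs, lamZ_sub (Nat.zero_le _)]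
    simp only [pow_zero, Module.End.one_apply, map_smul, map_mul, map_pow, matRep_gen,
      Matrix.conjTranspose_smul, Matrix.conjTranspose_mul, Matrix.conjTranspose_pow,
      repGen_e_conjTranspose, repGen_kinv_conjTranspose, Complex.star_def, Complex.conj_ofReal,
      smul_smul, one_mul]
    rw [div_mul_cancel₀ _ hc]
  | succ n ih =>
    intro hn
    have h1 := matRep_ad_e l (ih (by omega))
    have h2 : step t l (-(l - n)) = step t l (l - n - 1) := by
      rw [← step_neg]; congr 1; ring
    have h3 : star (step t l (l - n - 1)) = step t l (l - n - 1) := by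
      simp only [step, Complex.star_def, Complex.conj_ofReal]
    have h4 : step t l (l - n - 1) ≠ 0 := step_ne_zero ht (by omega) (by omega)
    rw [ad_e_lamZ ht, ad_f_lamZ ht, h2, map_smul, map_smul, Matrix.conjTranspose_smul, h3,
      smul_comm] at h1
    have h5 := smul_right_injective _ h4 h1
    rw [show -((l : ℤ) - (n + 1 : ℕ)) = -(l - n) + 1 by push_cast; ring,
      show (l : ℤ) - (n + 1 : ℕ) = l - n - 1 by push_cast; ring, h5, pow_succ' (-((t : ℂ) ^ 2)⁻¹),
      mul_assoc]

/-- The element `e^l k^{-l}` maps the weight vector `e_0` to a non-zero multiple of `e_l`. -/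
theorem matRep_lamZ_self_ne_zero (ht : t ^ 2 ≠ 1) (l : ℕ) : matRep t l (lamZ t l l) ≠ 0 := by
  have h0 : (t : ℂ) ≠ 0 := ofReal_ne_zero'
  have he (n : ℕ) (hn : n ≤ l) : ∃ s : ℂ, s ≠ 0 ∧
      (rep t l (e t) ^ n) (vecZ l (l - n)) = s • vecZ l l := by
    induction n with
    | zero => exact ⟨1, one_ne_zero, by simp⟩
    | succ n ih =>
      obtain ⟨s, hs, h⟩ := ih (by omega)
      refine ⟨step t l (l - (n + 1 : ℕ)) * s,
        mul_ne_zero (step_ne_zero ht (by omega) (by omega)) hs, ?_⟩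
      rw [pow_succ, Module.End.mul_apply, rep_e_vecZ, map_smul,
        show (l : ℤ) - (n + 1 : ℕ) + 1 = l - n by push_cast; ring, h, smul_smul]
  have hk (n : ℕ) : (rep t l (kinv t) ^ n) (vecZ l 0) = vecZ l 0 := by
    induction n with
    | zero => rfl
    | succ n ih => rw [pow_succ, Module.End.mul_apply, rep_kinv_vecZ]; simp [ih]
  obtain ⟨s, hs, h⟩ := he l le_rfl
  rw [sub_self] at h
  have hc := lamCoeff_zero_ne_zero ht l
  intro hz
  have h1 := lamZ_sub (t := t) (l := l) (Nat.zero_le _)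
  rw [Nat.cast_zero, sub_zero, pow_zero, Module.End.one_apply] at h1
  have h2 : rep t l (lamZ t l l) (vecZ l 0) = 0 := by rw [rep_apply, hz, Matrix.zero_mulVec]
  rw [h1, map_smul, map_mul, map_pow, map_pow, LinearMap.smul_apply, Module.End.mul_apply, hk, h,
    smul_smul] at h2
  have h3 := (smul_eq_zero.1 h2).resolve_left (mul_ne_zero hc hs)
  have h4 := congrFun h3 ⟨l, Finset.mem_Icc.2 ⟨by omega, le_rfl⟩⟩
  rw [vecZ_apply] at h4
  simp at h4

theorem centralElt_clebschGordan (l : ℕ) : centralElt t (clebschGordan t l l) =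
    ∑ m : Weight l, (((-1) ^ (l - m : ℤ) * t ^ (-(2 * (m : ℤ))) /
      Real.sqrt (qInt t (2 * l + 1)) : ℝ) : ℂ) • (lamZ t l m * lamZ t l (-m)) := by
  refine Finset.sum_congr rfl fun m _ => ?_
  simp only [clebschGordan_apply, Weight.eq_neg_iff, ite_smul, zero_smul]
  rw [Finset.sum_ite_eq' Finset.univ m.neg]
  simp only [Finset.mem_univ, if_true]
  rw [lamZ_coe, ← lamZ_coe m.neg]
  rfl

theorem centralElt_clebschGordan_ne_zero (ht : t ^ 2 ≠ 1) (l : ℕ) :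
    centralElt t (clebschGordan t l l) ≠ 0 := by
  obtain ⟨s, hs⟩ := exists_matRep_lamZ_neg ht l
  have h0 : t ≠ 0 := NeZero.ne t
  have hq : 0 < qInt t (2 * l + 1) := qInt_pos ht (by positivity)
  have hl := matRep_lamZ_self_ne_zero ht l
  -- At `n = 2l` the relation expresses `π(λ_l)`, which is non-zero, as a multiple of `s`.
  have hs0 : s ≠ 0 := by
    rintro rfl
    have h1 := hs (2 * l) le_rfl
    rw [mul_zero, zero_smul, show -((l : ℤ) - (2 * l : ℕ)) = l by push_cast; ring] at h1
    exact hl h1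
  set κ : ℂ := s * ((t ^ (-(2 * (l : ℤ))) / Real.sqrt (qInt t (2 * l + 1)) : ℝ) : ℂ) with hκ
  have hκ0 : κ ≠ 0 := by
    refine mul_ne_zero hs0 (Complex.ofReal_ne_zero.2 (div_ne_zero (zpow_ne_zero _ h0) ?_))
    exact (Real.sqrt_pos.2 hq).ne'
  -- With `m = l - n`, the coefficient `(-1)^n t^{-2l} t^{2n}` meets the factor `(-t⁻²)^n s`; the
  -- product does not depend on `n`.
  have key : matRep t l (centralElt t (clebschGordan t l l)) =
      κ • ∑ m : Weight l, matRep t l (lamZ t l m) * (matRep t l (lamZ t l m))ᴴ := by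
    rw [centralElt_clebschGordan, map_sum, Finset.smul_sum]
    refine Finset.sum_congr rfl fun m _ => ?_
    obtain ⟨n, hn, hm⟩ : ∃ n : ℕ, n ≤ 2 * l ∧ (m : ℤ) = l - n := by
      have := Finset.mem_Icc.1 m.2
      exact ⟨(l - m : ℤ).toNat, by omega, by omega⟩
    rw [hm, map_smul, map_mul, hs n hn, mul_smul_comm, smul_smul, hκ]
    congr 1
    rw [show (l : ℤ) - (l - n) = n by ring,
      show -(2 * ((l : ℤ) - n)) = -(2 * l) + (2 * n : ℕ) by push_cast; ring, zpow_add₀ h0,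
      zpow_natCast, zpow_natCast, neg_eq_neg_one_mul ((t : ℂ) ^ 2)⁻¹, mul_pow, pow_mul]
    push_cast
    have h1 : ((-1 : ℂ) ^ n) * (-1) ^ n = 1 := by rw [← mul_pow]; norm_num
    have h2 : ((t : ℂ) ^ 2) ^ n * (((t : ℂ) ^ 2)⁻¹) ^ n = 1 := by
      rw [← mul_pow, mul_inv_cancel₀ (sq_ne_zero' t), one_pow]
    linear_combination (s * (t : ℂ) ^ (-(2 * (l : ℤ))) / (Real.sqrt (qInt t (2 * l + 1)) : ℂ)) *
      (((t : ℂ) ^ 2) ^ n * (((t : ℂ) ^ 2)⁻¹) ^ n * h1 + h2)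
  intro h
  rw [h, map_zero, eq_comm, smul_eq_zero] at key
  -- Each `tr (M M*)` is non-negative, so a zero sum makes every one vanish, in particular the one
  -- for `m = l`.
  have h1 := congrArg Matrix.trace (key.resolve_left hκ0)
  rw [Matrix.trace_sum, Matrix.trace_zero] at h1
  open scoped ComplexOrder in
  have h2 := (Finset.sum_eq_zero_iff_of_nonneg fun (m : Weight l) _ =>
    (Matrix.posSemidef_self_mul_conjTranspose (matRep t l (lamZ t l m))).trace_nonneg).1 h1
      ⟨l, Finset.mem_Icc.2 ⟨by omega, le_rfl⟩⟩ (Finset.mem_univ _)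
  open scoped ComplexOrder in
  exact hl (Matrix.trace_mul_conjTranspose_self_eq_zero_iff.1 h2)

theorem centralElt_smul {j i : ℕ} (s : ℂ) (c : Weight j → Weight i → ℂ) :
    centralElt t (s • c) = s • centralElt t c := by
  simp [centralElt, Finset.smul_sum, smul_smul]

end Nonvanishing

end QuantumSU2

open QuantumSU2 HopfRep in
theorem mainTheorem9 (t : ℝ) [NeZero t] (ht : t ^ 2 ≠ 1) (j i : ℕ) :
    IsTrivialClebschGordan t j i (clebschGordan t j i) ∧
    ∀ c : Weight j → Weight i → ℂ, IsTrivialClebschGordan t j i c →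
      centralElt t c ∈ invariants (ad : U t →ₗ[ℂ] Module.End ℂ (U t)) ∧
      (j = i → Module.finrank ℂ (ℂ ∙ centralElt t c) = 1) ∧
      (j ≠ i → centralElt t c = 0) ∧
      centralElt t c ∈ Subalgebra.center ℂ (U t) := by
  refine ⟨isTrivialClebschGordan_clebschGordan ht j i, fun c hc => ?_⟩
  have hinv := centralElt_mem_invariants ht hc.1
  refine ⟨hinv, ?_, fun hji => ?_, mem_center_of_mem_invariants_ad hinv⟩
  · rintro rfl
    obtain ⟨s, hs, rfl⟩ := hc.exists_eq_smul ht
    refine finrank_span_singleton ?_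
    rw [centralElt_smul]
    exact smul_ne_zero hs (centralElt_clebschGordan_ne_zero ht j)
  · rw [hc.eq_zero ht hji]
    simp [centralElt]
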